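/- Let $\mathcal H\neq 0$ and $\mathcal H'$ be finite-dimensional complex Hilbert spaces and let $\mathcal E:\mathcal B(\mathcal H)\to\mathcal B(\mathcal H')$ be a completely positive trace-preserving (CPTP) linear map. Let $\|A\|_1=\operatorname{tr}\sqrt{A^\dagger A}$. A code is an arbitrary set $\mathcal C$ of density operators on $\mathcal H$; write $\operatorname{conv}\mathcal C$ for its convex hull. A code $\mathcal C$ is preserved by $\mathcal E$ (the Weak, or isometry, condition) if $$\|\mathcal E(p\rho-(1-p)\sigma)\|_1=\|p\rho-(1-p)\sigma\|_1\qquad\text{for all }\rho,\sigma\in\operatorname{conv}\mathcal C,\ p\in[0,1].$$ Two codes $\mathcal C_1,\mathcal C_2$ are isometric if there is a linear map $f$ that restricts to a bijection $\mathcal C_1\to\mathcal C_2$ and satisfies $\|pf(\rho)-(1-p)f(\sigma)\|_1=\|p\rho-(1-p)\sigma\|_1$ for all $\rho,\sigma\in\operatorname{conv}\mathcal C_1$ and $p\in[0,1]$. A preserved code $\mathcal C$ is maximum if there is no preserved code $\mathcal C_{\mathrm{big}}$ such that $\mathcal C$ is isometric to a strict subset of $\mathcal C_{\mathrm{big}}$.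 A code $\mathcal C$ is fixed by a CPTP map $\Phi$ (the Strong condition) if $\Phi(\rho)=\rho$ for all $\rho\in\mathcal C$. Then: 1. For every maximum preserved code $\mathcal C$ of $\mathcal E$ there is a CPTP map $\mathcal R:\mathcal B(\mathcal H')\to\mathcal B(\mathcal H)$ such that $\mathcal R\circ\mathcal E(\rho)=\rho$ for all $\rho\in\mathcal C$. 2. Conversely, if $\mathcal C$ is any code for which there is a CPTP map $\mathcal R:\mathcal B(\mathcal H')\to\mathcal B(\mathcal H)$ such that $\mathcal R\circ\mathcal E$ fixes $\mathcal C$, then $\mathcal C$ is preserved by $\mathcal E$. In particular, once a recovery is allowed, the Weak and the Strong conditions agree in this sense. -/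

import Mathlib

noncomputable section

namespace QuantumCode

open scoped Matrix MatrixOrder ComplexOrder

variable {n m : Type*} [Fintype n] [DecidableEq n] [Fintype m] [DecidableEq m]

/-- The trace norm (1-norm) `‖A‖₁ = tr |A| = tr √(Aᴴ A)` of a complex square matrix. -/
def traceNorm (A : Matrix n n ℂ) : ℝ := (CFC.sqrt (Aᴴ * A)).trace.re

/-- The state space: the density matrices, i.e. positive semidefinite matrices of trace one. -/
def stateSpace (n : Type*) [Fintype n] : Set (Matrix n n ℂ) :=
  {ρ | ρ.PosSemidef ∧ ρ.trace = 1}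

/-- Complete positivity: for every `k`, the map `id ⊗ Φ` on `k × k` block matrices, which applies
`Φ` to each block, sends positive semidefinite matrices to positive semidefinite matrices.
(`Matrix.comp` reads a block matrix as an ordinary matrix.) -/
def IsCompletelyPositive (Φ : Matrix n n ℂ →ₗ[ℂ] Matrix m m ℂ) : Prop :=
  ∀ (k : ℕ) (X : Matrix (Fin k) (Fin k) (Matrix n n ℂ)),
    (Matrix.comp (Fin k) (Fin k) n n ℂ X).PosSemidef →
      (Matrix.comp (Fin k) (Fin k) m m ℂ (X.map Φ)).PosSemidef

/-- CPTP: completely positive and trace preserving. -/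
structure IsCPTP (Φ : Matrix n n ℂ →ₗ[ℂ] Matrix m m ℂ) : Prop where
  completelyPositive : IsCompletelyPositive Φ
  trace_map : ∀ X : Matrix n n ℂ, (Φ X).trace = X.trace

/-- Two codes are isometric if some linear bijection between them preserves all weighted 1-norm
distances on the convex hull of the first. (A linear map on the span of a code always extends to
the whole matrix space.) -/
def IsIsometric (C₁ : Set (Matrix n n ℂ)) (C₂ : Set (Matrix m m ℂ)) : Prop :=
  ∃ f : Matrix n n ℂ →ₗ[ℝ] Matrix m m ℂ, Set.BijOn f C₁ C₂ ∧
    ∀ ρ ∈ convexHull ℝ C₁, ∀ σ ∈ convexHull ℝ C₁, ∀ p ∈ Set.Icc (0 : ℝ) 1,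
      traceNorm (p • f ρ - (1 - p) • f σ) = traceNorm (p • ρ - (1 - p) • σ)

/-- `C` is a code (a set of states) which is preserved by `E`, i.e. satisfies the Weak Condition:
`E` preserves all weighted 1-norm distances on the convex hull of `C`. -/
def IsPreserved (E : Matrix n n ℂ →ₗ[ℂ] Matrix m m ℂ) (C : Set (Matrix n n ℂ)) : Prop :=
  C ⊆ stateSpace n ∧
    ∀ ρ ∈ convexHull ℝ C, ∀ σ ∈ convexHull ℝ C, ∀ p ∈ Set.Icc (0 : ℝ) 1,
      traceNorm (E (p • ρ - (1 - p) • σ)) = traceNorm (p • ρ - (1 - p) • σ)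

/-- A preserved code is maximum if it is not isometric to a strict subset of a preserved code. -/
def IsMaximumPreserved (E : Matrix n n ℂ →ₗ[ℂ] Matrix m m ℂ) (C : Set (Matrix n n ℂ)) : Prop :=
  IsPreserved E C ∧
    ¬ ∃ Cbig Csmall : Set (Matrix n n ℂ), IsPreserved E Cbig ∧ Csmall ⊂ Cbig ∧ IsIsometric C Csmall

/-- The Strong Condition: `C` is fixed by `Φ` if `Φ` leaves every state of `C` unchanged. -/
def IsFixed (Φ : Matrix n n ℂ →ₗ[ℂ] Matrix n n ℂ) (C : Set (Matrix n n ℂ)) : Prop :=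
  ∀ ρ ∈ C, Φ ρ = ρ

end QuantumCode

end

noncomputable section

set_option linter.unusedSectionVars false

namespace QuantumCode

open scoped Matrix MatrixOrder ComplexOrder Kronecker

/-! ### Functional calculus of Hermitian matrices. -/

section FunctionalCalculus

variable {n : Type*} [Fintype n] [DecidableEq n]

/-! The converse is data processing: channels contract the trace norm, so if `R` undoes `E` on the
code, neither can contract strictly there.

For the direct part, let `P` be the joint support of the code `C`, let `K i` be Kraus operators of
`E`, and let `A` be the algebra of operators on the range of `P` commuting with all `P (K i)ᴴ (K j)
P`. Orthogonal positive elements of `A` have orthogonal images, so `E` is isometric on Hermitian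
elements of `A` and the states of `A` form a preserved code. In the other direction, if `E`
preserves the norm of an `X` nondegenerate on the range of `P`, an optimal test on the output is
also optimal for `X`, which forces the positive spectral projection of `X` into `A`
(`specProj_mem_correctableAlgebra_of_traceNorm_map`). The trace-orthogonal projection `e` onto `A`
keeps the value of such tests, so it loses no norm on the span of `C`, and it embeds `C`
isometrically into the states of `A`. Maximality makes this embedding onto.

Hence every projection `W` of `A` has a unique lift through `e` to the span of `C`, and the lift is
positive. If `D` lifts `P`, comparing supports shows that `W` lifts to `D * W` and that `D` commutes
with `W`. By spectral decomposition each `ρ` in `C` is `D * e ρ`, with `e ρ` in `A` commuting with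
`D`. A Petz-type channel built from `D` restores all such products (`exists_recovery`). -/

lemma continuousOn_spectrum (f : ℝ → ℝ) (X : Matrix n n ℂ) : ContinuousOn f (spectrum ℝ X) :=
  -- The spectrum is finite, so discontinuous functions such as indicators are admissible.
  (Matrix.finite_real_spectrum (A := X)).continuousOn f

lemma cfc_mul_cfc (f g : ℝ → ℝ) (X : Matrix n n ℂ) :
    cfc f X * cfc g X = cfc (fun x => f x * g x) X :=
  (cfc_mul f g X (continuousOn_spectrum f X) (continuousOn_spectrum g X)).symm

lemma cfc_add_cfc (f g : ℝ → ℝ) (X : Matrix n n ℂ) :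
    cfc f X + cfc g X = cfc (fun x => f x + g x) X :=
  (cfc_add X f g (continuousOn_spectrum f X) (continuousOn_spectrum g X)).symm

lemma cfc_sub_cfc (f g : ℝ → ℝ) (X : Matrix n n ℂ) :
    cfc f X - cfc g X = cfc (fun x => f x - g x) X :=
  (cfc_sub f g X (continuousOn_spectrum f X) (continuousOn_spectrum g X)).symm

lemma isHermitian_cfc (f : ℝ → ℝ) (X : Matrix n n ℂ) : (cfc f X).IsHermitian :=
  cfc_predicate (R := ℝ) (p := IsSelfAdjoint) f X

lemma posSemidef_cfc {f : ℝ → ℝ} (hf : ∀ x, 0 ≤ f x) (X : Matrix n n ℂ) : (cfc f X).PosSemidef :=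
  Matrix.nonneg_iff_posSemidef.mp (cfc_nonneg fun x _ => hf x)

lemma commute_cfc {X Y : Matrix n n ℂ} (h : Commute X Y) (f : ℝ → ℝ) : Commute (cfc f X) Y :=
  h.cfc_real f

/-- The positive part of a Hermitian matrix. -/
def pos (X : Matrix n n ℂ) : Matrix n n ℂ := cfc (fun x : ℝ => max x 0) X

/-- The negative part of a Hermitian matrix. -/
def neg (X : Matrix n n ℂ) : Matrix n n ℂ := cfc (fun x : ℝ => max (-x) 0) X

/-- The spectral projection of a Hermitian matrix for a set of real numbers. -/
def specProj (s : Set ℝ) (X : Matrix n n ℂ) : Matrix n n ℂ := cfc (s.indicator 1) X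

lemma posSemidef_pos (X : Matrix n n ℂ) : (pos X).PosSemidef :=
  posSemidef_cfc (fun _ => le_max_right _ _) X

lemma posSemidef_neg (X : Matrix n n ℂ) : (neg X).PosSemidef :=
  posSemidef_cfc (fun _ => le_max_right _ _) X

lemma cfc_self {X : Matrix n n ℂ} (hX : X.IsHermitian) : cfc (fun x : ℝ => x) X = X :=
  cfc_id' ℝ X hX

lemma cfc_const_one {X : Matrix n n ℂ} (hX : X.IsHermitian) : cfc (fun _ : ℝ => 1) X = 1 :=
  _root_.cfc_const_one ℝ X hX

lemma pos_sub_neg {X : Matrix n n ℂ} (hX : X.IsHermitian) : pos X - neg X = X := by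
  rw [pos, neg, cfc_sub_cfc]
  conv_rhs => rw [← cfc_self hX]
  congr 1
  ext x
  rcases le_total x 0 with h | h <;> simp [h]

lemma pos_mul_neg {X : Matrix n n ℂ} : pos X * neg X = 0 := by
  rw [pos, neg, cfc_mul_cfc]
  convert cfc_const_zero ℝ X using 2
  ext x
  rcases le_total x 0 with h | h <;> simp [h]

lemma isHermitian_specProj (s : Set ℝ) (X : Matrix n n ℂ) : (specProj s X).IsHermitian :=
  isHermitian_cfc _ X

lemma posSemidef_specProj (s : Set ℝ) (X : Matrix n n ℂ) : (specProj s X).PosSemidef :=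
  posSemidef_cfc (fun x => Set.indicator_nonneg (fun _ _ => zero_le_one) x) X

lemma specProj_mul_self (s : Set ℝ) (X : Matrix n n ℂ) :
    specProj s X * specProj s X = specProj s X := by
  rw [specProj, cfc_mul_cfc]
  congr 1
  ext x
  by_cases h : x ∈ s <;> simp [h]

lemma specProj_add_compl (s : Set ℝ) {X : Matrix n n ℂ} (hX : X.IsHermitian) :
    specProj s X + specProj sᶜ X = 1 := by
  rw [specProj, specProj, cfc_add_cfc, ← cfc_const_one hX]
  congr 1
  ext x
  by_cases h : x ∈ s <;> simp [h]

lemma commute_specProj {X Y : Matrix n n ℂ} (h : Commute X Y) (s : Set ℝ) :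
    Commute (specProj s X) Y := commute_cfc h _

lemma specProj_mul_pos (X : Matrix n n ℂ) : specProj (Set.Ioi 0) X * pos X = pos X := by
  rw [specProj, pos, cfc_mul_cfc]
  congr 1
  ext x
  rcases lt_or_ge 0 x with h | h <;> simp [Set.indicator, h, not_lt.mpr]

lemma specProj_mul_neg (X : Matrix n n ℂ) : specProj (Set.Ioi 0) X * neg X = 0 := by
  rw [specProj, neg, cfc_mul_cfc]
  convert cfc_const_zero ℝ X using 2
  ext x
  rcases lt_or_ge 0 x with h | h
  · simp [Set.indicator, le_of_lt h]
  · simp [Set.indicator, not_lt.mpr h]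

/-- A spectral projection for a set not containing zero is a multiple of the matrix. -/
lemma mul_cfc_eq_specProj {s : Set ℝ} {f : ℝ → ℝ} (hf : ∀ x ∈ s, f x ≠ 0) (X : Matrix n n ℂ) :
    ∃ Y, cfc f X * Y = specProj s X ∧ Y * cfc f X = specProj s X := by
  classical
  refine ⟨cfc (s.indicator fun x => (f x)⁻¹) X, ?_, ?_⟩ <;>
  · rw [specProj, cfc_mul_cfc]
    congr 1
    ext x
    by_cases h : x ∈ s
    · simp [h, hf x h]
    · simp [h]

lemma sqrt_mul_sqrt {X : Matrix n n ℂ} (hX : X.PosSemidef) : CFC.sqrt X * CFC.sqrt X = X :=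
  CFC.sqrt_mul_sqrt_self X (Matrix.nonneg_iff_posSemidef.mpr hX)

lemma posSemidef_sqrt (X : Matrix n n ℂ) : (CFC.sqrt X).PosSemidef :=
  Matrix.nonneg_iff_posSemidef.mp (CFC.sqrt_nonneg X)

lemma sqrt_mul_sqrt' {X : Matrix n n ℂ} (hX : X.PosSemidef) : (CFC.sqrt X)ᴴ * CFC.sqrt X = X := by
  rw [(posSemidef_sqrt X).isHermitian.eq, sqrt_mul_sqrt hX]

lemma commute_sqrt {X Y : Matrix n n ℂ} (h : Commute X Y) : Commute (CFC.sqrt X) Y := by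
  exact h.cfcₙ_nnreal _

/-- If `M X Mᴴ` has trace zero and `X ≥ 0`, then `M X = 0`. -/
lemma mul_eq_zero_of_trace {m : Type*} [Fintype m] {X : Matrix n n ℂ} (hX : X.PosSemidef)
    {M : Matrix m n ℂ} (h : (M * X * Mᴴ).trace = 0) : M * X = 0 := by
  have h1 : M * CFC.sqrt X = 0 := by
    rw [← Matrix.trace_mul_conjTranspose_self_eq_zero_iff, ← h, Matrix.conjTranspose_mul,
      (posSemidef_sqrt X).isHermitian.eq]
    conv_rhs => rw [← sqrt_mul_sqrt hX]
    simp only [Matrix.mul_assoc]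
  rw [← sqrt_mul_sqrt hX, ← Matrix.mul_assoc, h1, Matrix.zero_mul]

lemma trace_mul_nonneg {X Y : Matrix n n ℂ} (hX : X.PosSemidef) (hY : Y.PosSemidef) :
    0 ≤ (X * Y).trace := by
  rw [← sqrt_mul_sqrt' hY, ← Matrix.mul_assoc, Matrix.trace_mul_comm, ← Matrix.mul_assoc]
  exact (hX.mul_mul_conjTranspose_same _).trace_nonneg

/-- For positive semidefinite matrices, `tr (X Y) = 0` forces `X Y = 0`. -/
lemma mul_eq_zero_of_trace_mul {X Y : Matrix n n ℂ} (hX : X.PosSemidef) (hY : Y.PosSemidef)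
    (h : (Y * X).trace = 0) : Y * X = 0 := by
  have h1 : CFC.sqrt Y * X = 0 := by
    apply mul_eq_zero_of_trace hX
    rw [Matrix.trace_mul_comm, ← Matrix.mul_assoc, sqrt_mul_sqrt' hY, h]
  rw [← sqrt_mul_sqrt hY, Matrix.mul_assoc, h1, Matrix.mul_zero]

end FunctionalCalculus

/-! ### Trace norm, Helstrom measurements and contractivity. -/

section TraceNorm

variable {n m : Type*} [Fintype n] [DecidableEq n] [Fintype m] [DecidableEq m]

lemma traceNorm_sub_of_mul_eq_zero {A B : Matrix n n ℂ} (hA : A.PosSemidef) (hB : B.PosSemidef)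
    (hAB : A * B = 0) : traceNorm (A - B) = A.trace.re + B.trace.re := by
  have hBA : B * A = 0 := by
    have := congrArg Matrix.conjTranspose hAB
    rwa [Matrix.conjTranspose_mul, hA.isHermitian.eq, hB.isHermitian.eq,
      Matrix.conjTranspose_zero] at this
  -- The cross terms vanish, so `(A - B)²` and `(A + B)²` agree and the absolute value is `A + B`.
  have h : CFC.sqrt ((A - B)ᴴ * (A - B)) = A + B := by
    apply CFC.sqrt_unique
    · rw [Matrix.conjTranspose_sub, hA.isHermitian.eq, hB.isHermitian.eq, add_mul, mul_add,
        mul_add, sub_mul, mul_sub, mul_sub, hAB, hBA]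
      abel
    · exact Matrix.nonneg_iff_posSemidef.mpr (hA.add hB)
  rw [traceNorm, h, Matrix.trace_add, Complex.add_re]

lemma traceNorm_eq_pos_add_neg {X : Matrix n n ℂ} (hX : X.IsHermitian) :
    traceNorm X = (pos X).trace.re + (neg X).trace.re := by
  conv_lhs => rw [← pos_sub_neg hX]
  exact traceNorm_sub_of_mul_eq_zero (posSemidef_pos X) (posSemidef_neg X) pos_mul_neg

/-- The Helstrom measurement attains the trace norm. -/
lemma traceNorm_eq_helstrom {X : Matrix n n ℂ} (hX : X.IsHermitian) :
    traceNorm X = (specProj (Set.Ioi 0) X * X).trace.re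
      - ((1 - specProj (Set.Ioi 0) X) * X).trace.re := by
  have h1 : specProj (Set.Ioi 0) X * X = pos X := by
    rw [← sub_zero (pos X), ← specProj_mul_neg X, ← specProj_mul_pos X, ← mul_sub,
      pos_sub_neg hX]
  have h2 : (1 - specProj (Set.Ioi 0) X) * X = -neg X := by
    have h3 := pos_sub_neg hX
    rw [sub_mul, one_mul, h1, ← sub_eq_zero]
    nth_rw 1 [← h3]
    abel
  rw [h1, h2, traceNorm_eq_pos_add_neg hX, Matrix.trace_neg, Complex.neg_re, sub_neg_eq_add]

lemma re_trace_mul_le {A B : Matrix n n ℂ} (hA : A.PosSemidef) (hB : (1 - B).PosSemidef) :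
    (B * A).trace.re ≤ A.trace.re := by
  have := (Complex.le_def.mp (trace_mul_nonneg hB hA)).1
  rw [sub_mul, one_mul, Matrix.trace_sub, Complex.sub_re, Complex.zero_re] at this
  linarith

lemma re_trace_mul_nonneg {A B : Matrix n n ℂ} (hA : A.PosSemidef) (hB : B.PosSemidef) :
    0 ≤ (A * B).trace.re := (Complex.le_def.mp (trace_mul_nonneg hA hB)).1

lemma re_trace_nonneg {A : Matrix n n ℂ} (hA : A.PosSemidef) :
    0 ≤ A.trace.re := (Complex.le_def.mp hA.trace_nonneg).1

lemma posSemidef_of_isHermitian_of_mul_self {P : Matrix n n ℂ} (hP : P.IsHermitian)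
    (h : P * P = P) : P.PosSemidef := by
  have := Matrix.posSemidef_conjTranspose_mul_self P
  rwa [hP.eq, h] at this

lemma posSemidef_one_sub {P : Matrix n n ℂ} (hP : P.IsHermitian)
    (h : P * P = P) : (1 - P).PosSemidef := by
  refine posSemidef_of_isHermitian_of_mul_self (Matrix.isHermitian_one.sub hP) ?_
  simp [sub_mul, mul_sub, h]

/-- No pair of effects exceeds the trace norm. -/
lemma re_trace_sub_le_traceNorm {X B₁ B₂ : Matrix n n ℂ} (hX : X.IsHermitian)
    (h₁ : B₁.PosSemidef) (h₁' : (1 - B₁).PosSemidef) (h₂ : B₂.PosSemidef)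
    (h₂' : (1 - B₂).PosSemidef) : (B₁ * X).trace.re - (B₂ * X).trace.re ≤ traceNorm X := by
  rw [traceNorm_eq_pos_add_neg hX]
  have e : ∀ B : Matrix n n ℂ, (B * X).trace.re = (B * pos X).trace.re - (B * neg X).trace.re := by
    intro B
    conv_lhs => rw [← pos_sub_neg hX]
    rw [mul_sub, Matrix.trace_sub, Complex.sub_re]
  have := re_trace_mul_le (posSemidef_pos X) h₁'
  have := re_trace_mul_le (posSemidef_neg X) h₂'
  have := re_trace_mul_nonneg h₂ (posSemidef_pos X)
  have := re_trace_mul_nonneg h₁ (posSemidef_neg X)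
  rw [e, e]
  linarith

lemma traceNorm_sub_le {A B : Matrix n n ℂ} (hA : A.PosSemidef) (hB : B.PosSemidef) :
    traceNorm (A - B) ≤ A.trace.re + B.trace.re := by
  set Q := specProj (Set.Ioi 0) (A - B)
  have hQ := posSemidef_specProj (Set.Ioi 0) (A - B)
  have hQ' : (1 - Q).PosSemidef :=
    posSemidef_one_sub (isHermitian_specProj _ _) (specProj_mul_self _ _)
  rw [traceNorm_eq_helstrom (hA.isHermitian.sub hB.isHermitian)]
  have := re_trace_mul_le hA hQ'
  have := re_trace_mul_le hB (B := 1 - Q) (by simpa using hQ)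
  have := re_trace_mul_nonneg hQ' hA
  have := re_trace_mul_nonneg hQ hB
  rw [mul_sub, mul_sub]
  simp only [Matrix.trace_sub, Complex.sub_re]
  linarith

/-- With `traceNorm_add_le`, this bounds the effect of a small positive shift, which later allows
passage from nondegenerate operators to arbitrary ones. -/
lemma traceNorm_le_add {X S : Matrix n n ℂ} (hX : X.IsHermitian) (hS : S.PosSemidef) :
    traceNorm X ≤ traceNorm (X + S) + S.trace.re := by
  have hXS := hX.add hS.isHermitian
  have h : X = pos (X + S) - (neg (X + S) + S) := by
    rw [← sub_sub, pos_sub_neg hXS, add_sub_cancel_right]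
  have := traceNorm_sub_le (posSemidef_pos (X + S)) ((posSemidef_neg (X + S)).add hS)
  rw [← h, Matrix.trace_add, Complex.add_re] at this
  rw [traceNorm_eq_pos_add_neg hXS]
  linarith

lemma traceNorm_add_le {X S : Matrix n n ℂ} (hX : X.IsHermitian) (hS : S.PosSemidef) :
    traceNorm (X + S) ≤ traceNorm X + S.trace.re := by
  have h : X + S = (pos X + S) - neg X := by
    rw [add_sub_right_comm, pos_sub_neg hX]
  rw [h, traceNorm_eq_pos_add_neg hX]
  refine (traceNorm_sub_le ((posSemidef_pos X).add hS) (posSemidef_neg X)).trans_eq ?_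
  rw [Matrix.trace_add, Complex.add_re]
  ring

lemma PosSemidef.eq_zero_of_re_trace {A : Matrix n n ℂ} (hA : A.PosSemidef)
    (h : A.trace.re ≤ 0) : A = 0 := by
  have h1 := mul_eq_zero_of_trace_mul hA Matrix.PosSemidef.one (by
    rw [one_mul]
    have h2 := Complex.le_def.mp hA.trace_nonneg
    exact Complex.ext (le_antisymm h h2.1) h2.2.symm)
  rwa [one_mul] at h1

lemma eq_zero_of_traceNorm_eq_zero {X : Matrix n n ℂ} (hX : X.IsHermitian)
    (h : traceNorm X = 0) : X = 0 := by
  rw [traceNorm_eq_pos_add_neg hX] at h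
  have h1 := re_trace_nonneg (posSemidef_pos X)
  have h2 := re_trace_nonneg (posSemidef_neg X)
  rw [← pos_sub_neg hX, PosSemidef.eq_zero_of_re_trace (posSemidef_pos X) (by linarith),
    PosSemidef.eq_zero_of_re_trace (posSemidef_neg X) (by linarith), sub_zero]

lemma traceNorm_smul {c : ℝ} (hc : 0 ≤ c) (X : Matrix n n ℂ) :
    traceNorm (c • X) = c * traceNorm X := by
  have h : CFC.sqrt ((c • X)ᴴ * (c • X)) = c • CFC.sqrt (Xᴴ * X) := by
    apply CFC.sqrt_unique
    · rw [smul_mul_smul_comm, sqrt_mul_sqrt (Matrix.posSemidef_conjTranspose_mul_self X),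
        Matrix.conjTranspose_smul, smul_mul_smul_comm]
      rfl
    · exact smul_nonneg hc (CFC.sqrt_nonneg _)
  rw [traceNorm, h, Matrix.trace_smul, traceNorm, Complex.smul_re, smul_eq_mul]

/-- A positive map which does not increase the trace contracts the trace norm. -/
lemma traceNorm_map_le {Φ : Matrix n n ℂ →ₗ[ℂ] Matrix m m ℂ}
    (hΦ : ∀ X : Matrix n n ℂ, X.PosSemidef → (Φ X).PosSemidef)
    (ht : ∀ X : Matrix n n ℂ, X.PosSemidef → (Φ X).trace.re ≤ X.trace.re)
    {X : Matrix n n ℂ} (hX : X.IsHermitian) : traceNorm (Φ X) ≤ traceNorm X := by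
  have h := traceNorm_sub_le (hΦ _ (posSemidef_pos X)) (hΦ _ (posSemidef_neg X))
  rw [← map_sub, pos_sub_neg hX] at h
  rw [traceNorm_eq_pos_add_neg hX]
  have := ht _ (posSemidef_pos X)
  have := ht _ (posSemidef_neg X)
  linarith

end TraceNorm

/-! ### Kraus decompositions. -/

section Kraus

variable {n m : Type*} [Fintype n] [DecidableEq n] [Fintype m] [DecidableEq m]

/-- Choi's theorem: a completely positive map has a Kraus decomposition. -/
lemma IsCompletelyPositive.exists_kraus {Φ : Matrix n n ℂ →ₗ[ℂ] Matrix m m ℂ}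
    (h : IsCompletelyPositive Φ) :
    ∃ (k : ℕ) (K : Fin k × m → Matrix m n ℂ), ∀ X, Φ X = ∑ r, K r * X * (K r)ᴴ := by
  let e := Fintype.equivFin n
  refine ⟨Fintype.card n, ?_⟩
  -- The unnormalised maximally entangled projector; its image `J` is the Choi matrix.
  let X₀ : Matrix (Fin (Fintype.card n)) (Fin (Fintype.card n)) (Matrix n n ℂ) :=
    Matrix.of fun p q => Matrix.single (e.symm p) (e.symm q) 1
  have hX₀ : (Matrix.comp _ _ n n ℂ X₀).PosSemidef := by
    have := Matrix.posSemidef_vecMulVec_self_star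
      (fun pa : Fin (Fintype.card n) × n => if e.symm pa.1 = pa.2 then (1 : ℂ) else 0)
    convert this using 1
    ext ⟨p, a⟩ ⟨q, b⟩
    simp only [X₀, Matrix.comp_apply, Matrix.of_apply, Matrix.single_apply, Matrix.vecMulVec_apply,
      Pi.star_apply, ite_and]
    split_ifs <;> simp
  have hJ := h _ X₀ hX₀
  set J := Matrix.comp (Fin (Fintype.card n)) (Fin (Fintype.card n)) m m ℂ (X₀.map Φ)
  obtain ⟨B, hB⟩ : ∃ B, J = Bᴴ * B := ⟨_, (sqrt_mul_sqrt' hJ).symm⟩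
  -- Each row of a factor `B` of the Choi matrix, reshaped and conjugated, is a Kraus operator.
  refine ⟨fun r => Matrix.of fun a i => star (B r (e i, a)), fun X => ?_⟩
  have hJe : ∀ i j a b, Φ (Matrix.single i j 1) a b = J (e i, a) (e j, b) := by
    intro i j a b
    simp [J, X₀, Matrix.comp_apply]
  have hX : X = ∑ i, ∑ j, X i j • Matrix.single i j (1 : ℂ) := by
    conv_lhs => rw [Matrix.matrix_eq_sum_single X]
    simp
  ext a b
  conv_lhs => rw [hX]
  simp only [map_sum, map_smul, Matrix.sum_apply, Matrix.smul_apply, hJe]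
  simp only [hB, Matrix.mul_apply, Matrix.conjTranspose_apply, Matrix.of_apply, smul_eq_mul,
    Finset.mul_sum, Finset.sum_mul, star_star]
  rw [Finset.sum_comm' (t' := Finset.univ) (s' := fun _ => Finset.univ) (by simp)]
  conv_rhs => rw [Finset.sum_comm]
  refine Finset.sum_congr rfl fun j _ => ?_
  rw [Finset.sum_comm]
  refine Finset.sum_congr rfl fun r _ => ?_
  refine Finset.sum_congr rfl fun i _ => ?_
  ring

/-- Maps in Kraus form are completely positive. -/
lemma isCompletelyPositive_of_kraus {ι : Type*} [Fintype ι] {Φ : Matrix n n ℂ →ₗ[ℂ] Matrix m m ℂ}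
    (K : ι → Matrix m n ℂ) (hΦ : ∀ X, Φ X = ∑ r, K r * X * (K r)ᴴ) :
    IsCompletelyPositive Φ := by
  intro k X hX
  -- The amplified map has Kraus operators `1 ⊗ K r`.
  have h : Matrix.comp (Fin k) (Fin k) m m ℂ (X.map Φ) =
      ∑ r, (Matrix.of fun (pa : Fin k × m) (qb : Fin k × n) =>
        if pa.1 = qb.1 then K r pa.2 qb.2 else 0) * Matrix.comp (Fin k) (Fin k) n n ℂ X *
        (Matrix.of fun (pa : Fin k × m) (qb : Fin k × n) =>
        if pa.1 = qb.1 then K r pa.2 qb.2 else 0)ᴴ := by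
    ext ⟨p, a⟩ ⟨q, b⟩
    simp only [Matrix.comp_apply, Matrix.map_apply, hΦ, Matrix.sum_apply, Matrix.mul_apply,
      Matrix.conjTranspose_apply, Matrix.of_apply, Fintype.sum_prod_type]
    simp [apply_ite, Finset.sum_ite_eq, ite_mul, Finset.sum_ite_irrel]
  rw [h]
  exact Matrix.posSemidef_sum _ fun r _ => hX.mul_mul_conjTranspose_same _

lemma posSemidef_kraus {ι : Type*} [Fintype ι] {Φ : Matrix n n ℂ →ₗ[ℂ] Matrix m m ℂ}
    {K : ι → Matrix m n ℂ} (hΦ : ∀ X, Φ X = ∑ r, K r * X * (K r)ᴴ)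
    {X : Matrix n n ℂ} (hX : X.PosSemidef) : (Φ X).PosSemidef := by
  rw [hΦ]
  exact Matrix.posSemidef_sum _ fun r _ => hX.mul_mul_conjTranspose_same _

/-- Passage to the Heisenberg picture by cyclicity of the trace. -/
lemma trace_kraus {ι : Type*} [Fintype ι] {Φ : Matrix n n ℂ →ₗ[ℂ] Matrix m m ℂ}
    {K : ι → Matrix m n ℂ} (hΦ : ∀ X, Φ X = ∑ r, K r * X * (K r)ᴴ) (X : Matrix n n ℂ)
    (Y : Matrix m m ℂ) : (Y * Φ X).trace = ((∑ r, (K r)ᴴ * Y * K r) * X).trace := by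
  rw [hΦ, Finset.mul_sum, Finset.sum_mul, Matrix.trace_sum, Matrix.trace_sum]
  refine Finset.sum_congr rfl fun r _ => ?_
  rw [← Matrix.mul_assoc, Matrix.trace_mul_comm]
  simp only [Matrix.mul_assoc]

lemma sum_kraus_eq_one {ι : Type*} [Fintype ι] {Φ : Matrix n n ℂ →ₗ[ℂ] Matrix m m ℂ}
    {K : ι → Matrix m n ℂ} (hΦ : ∀ X, Φ X = ∑ r, K r * X * (K r)ᴴ)
    (ht : ∀ X : Matrix n n ℂ, (Φ X).trace = X.trace) : ∑ r, (K r)ᴴ * K r = 1 := by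
  rw [Matrix.ext_iff_trace_mul_right]
  intro X
  have := trace_kraus hΦ X 1
  simpa [ht] using this.symm

lemma IsCPTP.posSemidef {Φ : Matrix n n ℂ →ₗ[ℂ] Matrix m m ℂ} (h : IsCPTP Φ)
    {X : Matrix n n ℂ} (hX : X.PosSemidef) : (Φ X).PosSemidef := by
  obtain ⟨k, K, hK⟩ := h.completelyPositive.exists_kraus
  exact posSemidef_kraus hK hX

lemma IsCPTP.traceNorm_map_le {Φ : Matrix n n ℂ →ₗ[ℂ] Matrix m m ℂ} (h : IsCPTP Φ)
    {X : Matrix n n ℂ} (hX : X.IsHermitian) : traceNorm (Φ X) ≤ traceNorm X :=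
  QuantumCode.traceNorm_map_le (fun _ => h.posSemidef) (fun X _ => by rw [h.trace_map]) hX

lemma IsCPTP.isHermitian_map {Φ : Matrix n n ℂ →ₗ[ℂ] Matrix m m ℂ} (h : IsCPTP Φ)
    {X : Matrix n n ℂ} (hX : X.IsHermitian) : (Φ X).IsHermitian := by
  rw [← pos_sub_neg hX, map_sub]
  exact (h.posSemidef (posSemidef_pos X)).isHermitian.sub
    (h.posSemidef (posSemidef_neg X)).isHermitian

end Kraus

/-! ### Recoverable codes are preserved. -/

section Converse

variable {n m : Type*} [Fintype n] [DecidableEq n] [Fintype m] [DecidableEq m]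

lemma convex_stateSpace : Convex ℝ (stateSpace n) := by
  rintro ρ ⟨h1, h2⟩ σ ⟨h3, h4⟩ a b ha hb hab
  refine ⟨(h1.smul ha).add (h3.smul hb), ?_⟩
  rw [Matrix.trace_add, Matrix.trace_smul, Matrix.trace_smul, h2, h4, ← add_smul, hab, one_smul]

lemma isHermitian_sub_of_mem {C : Set (Matrix n n ℂ)} (hC : C ⊆ stateSpace n)
    {ρ σ : Matrix n n ℂ} (hρ : ρ ∈ convexHull ℝ C) (hσ : σ ∈ convexHull ℝ C) (a b : ℝ) :
    (a • ρ - b • σ).IsHermitian := by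
  have h := convexHull_min hC convex_stateSpace
  refine Matrix.IsHermitian.sub ?_ ?_
  · exact (h hρ).1.isHermitian.smul (IsSelfAdjoint.all a)
  · exact (h hσ).1.isHermitian.smul (IsSelfAdjoint.all b)

/-- A code fixed after a recovery is preserved. -/
theorem isPreserved_of_isFixed {E : Matrix n n ℂ →ₗ[ℂ] Matrix m m ℂ} (hE : IsCPTP E)
    {C : Set (Matrix n n ℂ)} (hC : C ⊆ stateSpace n) {R : Matrix m m ℂ →ₗ[ℂ] Matrix n n ℂ}
    (hR : IsCPTP R) (hRE : IsFixed (R ∘ₗ E) C) : IsPreserved E C := by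
  refine ⟨hC, fun ρ hρ σ hσ p _ => ?_⟩
  have hfix : ∀ τ ∈ convexHull ℝ C, R (E τ) = τ := by
    have : convexHull ℝ C ⊆ {τ | R (E τ) = τ} := by
      refine convexHull_min hRE ?_
      intro x hx y hy a b _ _ _
      simp only [Set.mem_ofPred_eq, map_add, LinearMap.map_smul_of_tower] at *
      rw [hx, hy]
    exact this
  have hX := isHermitian_sub_of_mem hC hρ hσ p (1 - p)
  have hRX : R (E (p • ρ - (1 - p) • σ)) = p • ρ - (1 - p) • σ := by
    simp only [map_sub, LinearMap.map_smul_of_tower, hfix ρ hρ, hfix σ hσ]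
  -- `E` contracts, and so does `R`, which maps `E X` back to `X`.
  refine le_antisymm (hE.traceNorm_map_le hX) ?_
  conv_lhs => rw [← hRX]
  exact hR.traceNorm_map_le (hE.isHermitian_map hX)

end Converse

/-! ### The correctable algebra and its trace projection. -/

section Algebra

variable {n m ι : Type*} [Fintype n] [DecidableEq n] [Fintype m] [DecidableEq m] [Fintype ι]

/-- The correctable algebra of the operators `K` on the range of `P`: the operators on the range
of `P` which commute with all `P (K i)ᴴ (K j) P`. -/
def correctableAlgebra (K : ι → Matrix m n ℂ) (P : Matrix n n ℂ) :
    Submodule ℂ (Matrix n n ℂ) where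
  carrier := {a | P * a = a ∧ a * P = a ∧ ∀ i j, Commute a (P * (K i)ᴴ * K j * P)}
  add_mem' := by
    rintro a b ⟨h1, h2, h3⟩ ⟨h4, h5, h6⟩
    exact ⟨by rw [mul_add, h1, h4], by rw [add_mul, h2, h5],
      fun i j => (h3 i j).add_left (h6 i j)⟩
  zero_mem' := by simp
  smul_mem' := by
    rintro c a ⟨h1, h2, h3⟩
    exact ⟨by rw [Matrix.mul_smul, h1], by rw [Matrix.smul_mul, h2],
      fun i j => (h3 i j).smul_left c⟩

variable {K : ι → Matrix m n ℂ} {P : Matrix n n ℂ}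

lemma conjTranspose_mem_correctableAlgebra (hP : P.IsHermitian) {a : Matrix n n ℂ}
    (ha : a ∈ correctableAlgebra K P) : aᴴ ∈ correctableAlgebra K P := by
  obtain ⟨h1, h2, h3⟩ := ha
  refine ⟨?_, ?_, fun i j => ?_⟩
  · conv_lhs => rw [← hP.eq, ← Matrix.conjTranspose_mul, h2]
  · conv_lhs => rw [← hP.eq, ← Matrix.conjTranspose_mul, h1]
  · have h := congrArg Matrix.conjTranspose (h3 j i).eq
    simp only [Matrix.conjTranspose_mul, Matrix.conjTranspose_conjTranspose, hP.eq] at h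
    simp only [Commute, SemiconjBy, Matrix.mul_assoc] at h ⊢
    exact h.symm

lemma proj_mem_correctableAlgebra (hPP : P * P = P) : P ∈ correctableAlgebra K P := by
  refine ⟨hPP, hPP, fun i j => ?_⟩
  simp only [Commute, SemiconjBy, Matrix.mul_assoc, hPP]
  rw [← Matrix.mul_assoc P P, hPP]

lemma mul_mem_correctableAlgebra {a b : Matrix n n ℂ} (ha : a ∈ correctableAlgebra K P)
    (hb : b ∈ correctableAlgebra K P) : a * b ∈ correctableAlgebra K P :=
  ⟨by rw [← mul_assoc, ha.1], by rw [mul_assoc, hb.2.1],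
    fun i j => (ha.2.2 i j).mul_left (hb.2.2 i j)⟩

/-- The condition `0 ∉ s` keeps the kernel of `a`, and with it the complement of `P`, out of the
spectral projection. -/
lemma specProj_mem_correctableAlgebra {a : Matrix n n ℂ} (ha : a ∈ correctableAlgebra K P)
    (hs : a.IsHermitian) {s : Set ℝ} (h0 : 0 ∉ s) : specProj s a ∈ correctableAlgebra K P := by
  obtain ⟨Y, h1, h2⟩ := mul_cfc_eq_specProj (s := s) (f := fun x => x)
    (fun x hx h => h0 (h ▸ hx)) a
  rw [cfc_self hs] at h1 h2
  refine ⟨by rw [← h1, ← mul_assoc, ha.1], by rw [← h2, mul_assoc, ha.2.1],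
    fun i j => commute_specProj (ha.2.2 i j) s⟩

lemma pos_mem_correctableAlgebra {a : Matrix n n ℂ} (ha : a ∈ correctableAlgebra K P)
    (hs : a.IsHermitian) : pos a ∈ correctableAlgebra K P := by
  have h : pos a = specProj (Set.Ioi 0) a * a := by
    conv_rhs => rw [← sub_zero (specProj _ _ * a)]
    nth_rw 3 [← pos_sub_neg hs]
    rw [mul_sub, specProj_mul_neg, specProj_mul_pos, sub_zero, sub_zero]
  rw [h]
  exact mul_mem_correctableAlgebra
    (specProj_mem_correctableAlgebra ha hs (by simp)) ha

lemma neg_mem_correctableAlgebra {a : Matrix n n ℂ} (ha : a ∈ correctableAlgebra K P)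
    (hs : a.IsHermitian) : neg a ∈ correctableAlgebra K P := by
  have h : neg a = pos a - a := by
    rw [eq_sub_iff_add_eq, ← eq_sub_iff_add_eq', pos_sub_neg hs]
  rw [h]
  exact sub_mem (pos_mem_correctableAlgebra ha hs) ha

/-- A star-closed space of matrices has a projection which is orthogonal for the trace form. -/
lemma exists_trace_projection (S : Submodule ℂ (Matrix n n ℂ)) (hS : ∀ a ∈ S, aᴴ ∈ S) :
    ∃ e : Matrix n n ℂ →ₗ[ℂ] Matrix n n ℂ, (∀ X, e X ∈ S) ∧
      ∀ X, ∀ a ∈ S, (a * e X).trace = (a * X).trace := by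
  let B : LinearMap.BilinForm ℂ (Matrix n n ℂ) :=
    (LinearMap.mul ℂ (Matrix n n ℂ)).compr₂ (Matrix.traceLinearMap n ℂ ℂ)
  have hB : ∀ X Y, B X Y = (X * Y).trace := fun _ _ => rfl
  have hsymm : B.IsRefl := fun X Y h => by
    rw [hB] at h ⊢
    rw [Matrix.trace_mul_comm, h]
  -- Star closure enters here: each `a` may be paired with its own adjoint.
  have hnd : (B.restrict S).Nondegenerate := by
    have key : ∀ a : S, (∀ b : S, ((a : Matrix n n ℂ) * b).trace = 0) → a = 0 := by
      intro a h
      have := h ⟨_, hS a a.2⟩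
      exact Subtype.ext (Matrix.trace_mul_conjTranspose_self_eq_zero_iff.mp this)
    refine ⟨fun a h => key a h, fun a h => key a fun b => ?_⟩
    rw [Matrix.trace_mul_comm]
    exact h b
  have hc := LinearMap.BilinForm.isCompl_orthogonal_of_restrict_nondegenerate hsymm hnd
  refine ⟨S.subtype ∘ₗ S.projectionOnto _ hc, fun X => Subtype.prop _, fun X a ha => ?_⟩
  have h1 : X - S.projectionOnto _ hc X ∈ LinearMap.ker (S.projectionOnto _ hc) := by
    rw [LinearMap.mem_ker, map_sub, Submodule.projectionOnto_apply_left, sub_self]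
  rw [Submodule.ker_projectionOnto] at h1
  have h2 : (a * (X - S.projectionOnto _ hc X)).trace = 0 := h1 a ha
  rw [mul_sub, Matrix.trace_sub, sub_eq_zero] at h2
  exact h2.symm

/-- The trace-orthogonal projection onto the correctable algebra. -/
structure IsTraceProjection (K : ι → Matrix m n ℂ) (P : Matrix n n ℂ)
    (e : Matrix n n ℂ →ₗ[ℂ] Matrix n n ℂ) : Prop where
  mem : ∀ X, e X ∈ correctableAlgebra K P
  trace_mul : ∀ X, ∀ a ∈ correctableAlgebra K P, (a * e X).trace = (a * X).trace

variable {e : Matrix n n ℂ →ₗ[ℂ] Matrix n n ℂ}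

/-- The elements `(e X)ᴴ` and `e X` pair identically with the algebra when `X` is Hermitian, so
their difference, itself in the algebra, is orthogonal to itself. -/
lemma IsTraceProjection.isHermitian (he : IsTraceProjection K P e) (hP : P.IsHermitian)
    {X : Matrix n n ℂ} (hX : X.IsHermitian) : (e X).IsHermitian := by
  have hmem := sub_mem (conjTranspose_mem_correctableAlgebra hP (he.mem X)) (he.mem X)
  have hmem' := conjTranspose_mem_correctableAlgebra hP hmem
  rw [Matrix.IsHermitian, ← sub_eq_zero, ← Matrix.trace_conjTranspose_mul_self_eq_zero_iff]
  set d := (e X)ᴴ - e X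
  have h1 : (dᴴ * (e X)ᴴ).trace = (dᴴ * X).trace := by
    rw [← Matrix.conjTranspose_mul, Matrix.trace_conjTranspose, Matrix.trace_mul_comm,
      he.trace_mul X d hmem, ← Matrix.trace_conjTranspose, Matrix.conjTranspose_mul, hX.eq,
      Matrix.trace_mul_comm]
  rw [show dᴴ * d = dᴴ * (e X)ᴴ - dᴴ * e X from mul_sub _ _ _, Matrix.trace_sub, h1,
    he.trace_mul X _ hmem', sub_self]

/-- The negative part `N` of `e X` lies in the algebra, so `tr (N * e X) = tr (N * X) ≥ 0`; but `N *
e X = -N²`, whence `N = 0`. -/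
lemma IsTraceProjection.posSemidef (he : IsTraceProjection K P e) (hP : P.IsHermitian)
    {X : Matrix n n ℂ} (hX : X.PosSemidef) : (e X).PosSemidef := by
  have hH := he.isHermitian hP hX.isHermitian
  have h1 := re_trace_mul_nonneg (posSemidef_neg (e X)) hX
  have hpn : neg (e X) * pos (e X) = 0 := by
    have := congrArg Matrix.conjTranspose (pos_mul_neg (X := e X))
    rwa [Matrix.conjTranspose_mul, (posSemidef_neg _).isHermitian.eq,
      (posSemidef_pos _).isHermitian.eq, Matrix.conjTranspose_zero] at this
  have hN := neg_mem_correctableAlgebra (he.mem X) hH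
  rw [← he.trace_mul X _ hN] at h1
  have h2 : neg (e X) * e X = -(neg (e X) * neg (e X)) := by
    rw [← zero_sub, ← hpn, ← mul_sub, pos_sub_neg hH]
  have hsq : (neg (e X) * neg (e X)).PosSemidef := by
    have := Matrix.posSemidef_conjTranspose_mul_self (neg (e X))
    rwa [(posSemidef_neg _).isHermitian.eq] at this
  have h3 : neg (e X) * neg (e X) = 0 := by
    apply PosSemidef.eq_zero_of_re_trace hsq
    rw [h2, Matrix.trace_neg, Complex.neg_re] at h1
    linarith
  have h4 : neg (e X) = 0 := by
    rw [← Matrix.conjTranspose_mul_self_eq_zero, (posSemidef_neg _).isHermitian.eq, h3]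
  rw [← pos_sub_neg hH, h4, sub_zero]
  exact posSemidef_pos _

lemma IsTraceProjection.trace_map (he : IsTraceProjection K P e) (hPP : P * P = P)
    {X : Matrix n n ℂ} (hX : P * X = X) : (e X).trace = X.trace := by
  have := he.trace_mul X P (proj_mem_correctableAlgebra hPP)
  rwa [(he.mem X).1, hX] at this

/-- A channel is a trace norm isometry on the Hermitian part of its correctable algebra. -/
lemma traceNorm_map_of_mem_correctableAlgebra {Φ : Matrix n n ℂ →ₗ[ℂ] Matrix m m ℂ}
    (hΦ : ∀ X, Φ X = ∑ r, K r * X * (K r)ᴴ) (ht : ∀ X : Matrix n n ℂ, (Φ X).trace = X.trace)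
    {X : Matrix n n ℂ} (hX : X.IsHermitian) (hXA : X ∈ correctableAlgebra K P) :
    traceNorm (Φ X) = traceNorm X := by
  have h0 : Φ (pos X) * Φ (neg X) = 0 := by
    rw [hΦ, hΦ, Finset.sum_mul_sum]
    refine Finset.sum_eq_zero fun i _ => Finset.sum_eq_zero fun j _ => ?_
    have hp := pos_mem_correctableAlgebra hXA hX
    have hn := neg_mem_correctableAlgebra hXA hX
    -- Commutation moves `pos X` across the error operator to meet `neg X`.
    have h1 : pos X * (P * (K i)ᴴ * K j * P) * neg X = 0 := by
      rw [(hp.2.2 i j).eq, mul_assoc, pos_mul_neg, mul_zero]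
    calc K i * pos X * (K i)ᴴ * (K j * neg X * (K j)ᴴ)
        = K i * (pos X * P) * (K i)ᴴ * (K j * (P * neg X) * (K j)ᴴ) := by rw [hp.2.1, hn.1]
      _ = K i * (pos X * (P * (K i)ᴴ * K j * P) * neg X) * (K j)ᴴ := by
        simp only [Matrix.mul_assoc]
      _ = 0 := by rw [h1, Matrix.mul_zero, Matrix.zero_mul]
  rw [traceNorm_eq_pos_add_neg hX]
  conv_lhs => rw [← pos_sub_neg hX]
  rw [map_sub, traceNorm_sub_of_mul_eq_zero (posSemidef_kraus hΦ (posSemidef_pos X))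
    (posSemidef_kraus hΦ (posSemidef_neg X)) h0, ht, ht]

/-- If a channel preserves the trace norm of a nondegenerate Hermitian operator on the range of
`P`, its Helstrom projection lies in the correctable algebra. -/
lemma specProj_mem_correctableAlgebra_of_traceNorm_map {Φ : Matrix n n ℂ →ₗ[ℂ] Matrix m m ℂ}
    (hΦ : ∀ X, Φ X = ∑ r, K r * X * (K r)ᴴ) (ht : ∀ X : Matrix n n ℂ, (Φ X).trace = X.trace)
    (hP : P.IsHermitian)
    {X : Matrix n n ℂ} (hX : X.IsHermitian) (hPX : P * X = X)
    (hker : ∀ Z : Matrix n n ℂ, X * Z = 0 → P * Z = 0)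
    (hiso : traceNorm (Φ X) = traceNorm X) :
    specProj (Set.Ioi 0) X ∈ correctableAlgebra K P := by
  have hXP : X * P = X := by
    have := congrArg Matrix.conjTranspose hPX
    rwa [Matrix.conjTranspose_mul, hX.eq, hP.eq] at this
  set W := specProj (Set.Ioi 0) X with hW
  set W' := specProj (Set.Iio 0) X with hW'
  obtain ⟨Y, hY1, -⟩ := mul_cfc_eq_specProj (s := Set.Ioi 0) (f := fun x => max x 0)
    (fun x hx => by rw [max_eq_left (le_of_lt hx)]; exact ne_of_gt hx) X
  obtain ⟨Y', hY'1, -⟩ := mul_cfc_eq_specProj (s := Set.Iio 0) (f := fun x => max (-x) 0)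
    (fun x hx => by
      have hx : x < 0 := hx
      rw [max_eq_left (by linarith)]; linarith) X
  obtain ⟨U, hU1, hU2⟩ := mul_cfc_eq_specProj (s := Set.Ioi 0) (f := fun x => x)
    (fun x hx => ne_of_gt hx) X
  obtain ⟨U', hU'1, hU'2⟩ := mul_cfc_eq_specProj (s := Set.Iio 0) (f := fun x => x)
    (fun x hx => ne_of_lt hx) X
  rw [cfc_self hX] at hU1 hU2 hU'1 hU'2
  have hPW : P * W = W := by rw [hW, ← hU1, ← mul_assoc, hPX]
  have hWP : W * P = W := by rw [hW, ← hU2, mul_assoc, hXP]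
  have hPW' : P * W' = W' := by rw [hW', ← hU'1, ← mul_assoc, hPX]
  have hW'P : W' * P = W' := by rw [hW', ← hU'2, mul_assoc, hXP]
  -- Nondegeneracy: `X` annihilates `1 - (W + W')`, so `P` does too.
  have hsum : W + W' = P := by
    have h0 : X * (1 - (W + W')) = 0 := by
      nth_rw 1 [← cfc_self hX]
      rw [← cfc_const_one hX, hW, hW', specProj, specProj, cfc_add_cfc, cfc_sub_cfc, cfc_mul_cfc]
      convert cfc_const_zero ℝ X using 2
      ext x
      rcases lt_trichotomy x 0 with h | h | h
      · simp [Set.indicator, h, lt_asymm h]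
      · simp [h]
      · simp [Set.indicator, h, lt_asymm h]
    have := hker _ h0
    rw [mul_sub, mul_one, mul_add, hPW, hPW', sub_eq_zero] at this
    exact this.symm
  set Q := specProj (Set.Ioi 0) (Φ X) with hQ
  have hQH : Q.IsHermitian := isHermitian_specProj _ _
  have hQsq : Q * Q = Q := specProj_mul_self _ _
  have hQp : Q.PosSemidef := posSemidef_specProj _ _
  have hQ' : (1 - Q).PosSemidef := posSemidef_one_sub hQH hQsq
  have hΦX : (Φ X).IsHermitian := by
    rw [← pos_sub_neg hX, map_sub]
    exact (posSemidef_kraus hΦ (posSemidef_pos X)).isHermitian.sub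
      (posSemidef_kraus hΦ (posSemidef_neg X)).isHermitian
  have hΦp := posSemidef_kraus hΦ (posSemidef_pos X)
  have hΦn := posSemidef_kraus hΦ (posSemidef_neg X)
  have hnn1 := re_trace_mul_nonneg hQ' hΦp
  have hnn2 := re_trace_mul_nonneg hQp hΦn
  -- The trace norm drops by exactly twice the sum of these two nonnegative error terms, so equality
  -- kills both.
  have heq : ((1 - Q) * Φ (pos X)).trace.re = 0 ∧ (Q * Φ (neg X)).trace.re = 0 := by
    rw [traceNorm_eq_helstrom hΦX, traceNorm_eq_pos_add_neg hX, ← hQ] at hiso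
    have h1 : Φ X = Φ (pos X) - Φ (neg X) := by rw [← map_sub, pos_sub_neg hX]
    rw [h1] at hiso
    rw [← ht (pos X), ← ht (neg X)] at hiso
    simp only [mul_sub, sub_mul, one_mul, Matrix.trace_sub, Complex.sub_re] at hiso hnn1 hnn2 ⊢
    constructor <;> linarith
  -- A vanishing error probability is a sum of nonnegative Kraus contributions, each of which must
  -- vanish.
  have hcancel : ∀ (R : Matrix m m ℂ) (A : Matrix n n ℂ), R.IsHermitian → R * R = R →
      A.PosSemidef → (R * Φ A).trace.re = 0 → ∀ i, R * K i * A = 0 := by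
    intro R A hR hRR hA h
    have h1 : (R * Φ A).trace.re = ∑ i, ((R * K i) * A * (R * K i)ᴴ).trace.re := by
      rw [hΦ, Finset.mul_sum, Matrix.trace_sum, Complex.re_sum]
      refine Finset.sum_congr rfl fun i _ => ?_
      rw [Matrix.conjTranspose_mul, hR.eq, ← Matrix.mul_assoc (R * K i * A),
        Matrix.trace_mul_comm _ R]
      simp only [← Matrix.mul_assoc, hRR]
    rw [h] at h1
    have h2 := (Finset.sum_eq_zero_iff_of_nonneg (fun i _ =>
      re_trace_nonneg (hA.mul_mul_conjTranspose_same (R * K i)))).mp h1.symm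
    intro i
    apply mul_eq_zero_of_trace hA
    have h3 := Complex.le_def.mp (hA.mul_mul_conjTranspose_same (R * K i)).trace_nonneg
    exact Complex.ext (h2 i (Finset.mem_univ i)) h3.2.symm
  have hK1 : ∀ i, (1 - Q) * K i * W = 0 := fun i => by
    have h := hcancel (1 - Q) (pos X) (Matrix.isHermitian_one.sub hQH)
      (by simp [sub_mul, mul_sub, hQsq]) (posSemidef_pos X) heq.1 i
    rw [hW, ← hY1, ← Matrix.mul_assoc]
    exact (congrArg (· * Y) h).trans (Matrix.zero_mul _)
  have hK2 : ∀ i, Q * K i * W' = 0 := fun i => by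
    have h := hcancel Q (neg X) hQH hQsq (posSemidef_neg X) heq.2 i
    rw [hW', ← hY'1, ← Matrix.mul_assoc]
    exact (congrArg (· * Y') h).trans (Matrix.zero_mul _)
  have hWH : W.IsHermitian := isHermitian_specProj _ _
  have hW'H : W'.IsHermitian := isHermitian_specProj _ _
  -- The output test `Q` fixes every `K i * W` and annihilates every `K j * W'`, so no error
  -- operator connects the two ranges.
  have hcross : ∀ i j, W * (K i)ᴴ * K j * W' = 0 := by
    intro i j
    have h1 : K i * W = Q * K i * W := by
      have := hK1 i
      rwa [Matrix.sub_mul, Matrix.sub_mul, Matrix.one_mul, sub_eq_zero] at this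
    have h2 : W * (K i)ᴴ = W * (K i)ᴴ * Q := by
      have := congrArg Matrix.conjTranspose h1
      simpa only [Matrix.conjTranspose_mul, hWH.eq, hQH.eq, Matrix.mul_assoc] using this
    rw [h2, Matrix.mul_assoc, Matrix.mul_assoc, ← Matrix.mul_assoc Q, hK2 j, Matrix.mul_zero]
  have hcross' : ∀ i j, W' * (K i)ᴴ * K j * W = 0 := by
    intro i j
    have := congrArg Matrix.conjTranspose (hcross j i)
    simpa only [Matrix.conjTranspose_mul, hWH.eq, hW'H.eq, Matrix.mul_assoc,
      Matrix.conjTranspose_conjTranspose, Matrix.conjTranspose_zero] using this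
  refine ⟨hPW, hWP, fun i j => ?_⟩
  have h1 : W * (P * (K i)ᴴ * K j * P) = W * (K i)ᴴ * K j * W := by
    calc W * (P * (K i)ᴴ * K j * P) = (W * P) * (K i)ᴴ * K j * P := by
          simp only [Matrix.mul_assoc]
      _ = W * (K i)ᴴ * K j * W := by
          rw [hWP, ← hsum, Matrix.mul_add, hcross, add_zero]
  have h2 : (P * (K i)ᴴ * K j * P) * W = W * (K i)ᴴ * K j * W := by
    calc (P * (K i)ᴴ * K j * P) * W = P * (K i)ᴴ * K j * (P * W) := by
          simp only [Matrix.mul_assoc]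
      _ = W * (K i)ᴴ * K j * W := by
          rw [hPW, ← hsum, Matrix.add_mul, Matrix.add_mul, Matrix.add_mul, hcross', add_zero]
  exact h1.trans h2.symm

/-- The trace projection does not decrease the trace norm of a Hermitian operator whose Helstrom
projection lies in the correctable algebra. -/
lemma IsTraceProjection.traceNorm_le (he : IsTraceProjection K P e) (hP : P.IsHermitian)
    (hPP : P * P = P) {X : Matrix n n ℂ} (hX : X.IsHermitian) (hPX : P * X = X)
    (hW : specProj (Set.Ioi 0) X ∈ correctableAlgebra K P) :
    traceNorm X ≤ traceNorm (e X) := by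
  set W := specProj (Set.Ioi 0) X with hWdef
  have hWH : W.IsHermitian := isHermitian_specProj _ _
  have hWW : W * W = W := specProj_mul_self _ _
  have hPW : P - W ∈ correctableAlgebra K P := sub_mem (proj_mem_correctableAlgebra hPP) hW
  have hsub : (P - W) * (P - W) = P - W := by
    simp [sub_mul, mul_sub, hPP, hWW, hW.1, hW.2.1]
  have hsubH : (P - W).IsHermitian := hP.sub hWH
  -- The test `W`, `P - W` lies in the algebra, so it has the same value on `e X` as on `X`, where
  -- it is optimal.
  have h := re_trace_sub_le_traceNorm (he.isHermitian hP hX)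
    (posSemidef_of_isHermitian_of_mul_self hWH hWW) (posSemidef_one_sub hWH hWW)
    (posSemidef_of_isHermitian_of_mul_self hsubH hsub) (posSemidef_one_sub hsubH hsub)
  rw [he.trace_mul X _ hW, he.trace_mul X _ hPW] at h
  rw [traceNorm_eq_helstrom hX, ← hWdef, sub_mul, one_mul]
  rwa [sub_mul, hPX] at h

/-- Almost every shift of an operator along one of full support is nondegenerate. -/
lemma exists_nondegenerate_shift {X σ : Matrix n n ℂ} (hσP : σ * P = σ) (hXP : X * P = X)
    (hPP : P * P = P) (hσ : IsUnit (σ + (1 - P))) {δ : ℝ} (hδ : 0 < δ) :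
    ∃ ε : ℝ, 0 < ε ∧ ε < δ ∧ ∀ Z : Matrix n n ℂ, (X + ε • σ) * Z = 0 → P * Z = 0 := by
  obtain ⟨u, hu⟩ := hσ
  -- With `u = σ + (1 - P)`, one has `X + ε u = -u (-ε - u⁻¹ X)`, singular for only finitely many
  -- `ε`.
  have hfin : {ε : ℝ | -ε ∈ spectrum ℝ ((↑u⁻¹ : Matrix n n ℂ) * X)}.Finite :=
    (Matrix.finite_real_spectrum (A := (↑u⁻¹ : Matrix n n ℂ) * X)).preimage neg_injective.injOn
  obtain ⟨ε, ⟨h1, h2⟩, h3⟩ := (Set.Ioo_infinite hδ).exists_notMem_finite hfin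
  refine ⟨ε, h1, h2, fun Z hZ => ?_⟩
  have h4 : IsUnit (X + ε • (σ + (1 - P))) := by
    have h5 : IsUnit (algebraMap ℝ (Matrix n n ℂ) (-ε) - (↑u⁻¹ : Matrix n n ℂ) * X) :=
      spectrum.notMem_iff.mp h3
    have h6 := (u.isUnit.mul h5).neg
    convert h6 using 1
    rw [mul_sub, ← mul_assoc, Units.mul_inv, one_mul, ← hu, Algebra.algebraMap_eq_smul_one]
    simp
  have h7 : (X + ε • (σ + (1 - P))) * (P * Z) = 0 := by
    have : (X + ε • (σ + (1 - P))) * P = X + ε • σ := by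
      rw [add_mul, smul_mul_assoc, add_mul, sub_mul, hPP, hσP, hXP]
      simp
    rw [← mul_assoc, this, hZ]
  exact h4.mul_right_eq_zero.mp h7

end Algebra

/-! ### The joint support of a code. -/

section Support

variable {n : Type*} [Fintype n] [DecidableEq n]

/-- A nonempty set of states has a joint support projection, which is the support of some state
in its convex hull. -/
lemma exists_support {C : Set (Matrix n n ℂ)} (hC : C ⊆ stateSpace n) (hne : C.Nonempty) :
    ∃ σ ∈ convexHull ℝ C, ∃ P : Matrix n n ℂ, P.IsHermitian ∧ P * P = P ∧
      IsUnit (σ + (1 - P)) ∧ ∀ ρ ∈ convexHull ℝ C, P * ρ = ρ ∧ ρ * P = ρ := by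
  have hCs := convexHull_min hC convex_stateSpace
  let d : Matrix n n ℂ → ℕ := fun ρ => Module.finrank ℂ (LinearMap.ker (Matrix.mulVecLin ρ))
  -- A state with smallest kernel: its midpoint with any `ρ` has as kernel the intersection of both,
  -- so minimality puts the kernel of `σ` inside that of `ρ`.
  obtain ⟨σ, hσ, hmin⟩ : ∃ σ ∈ convexHull ℝ C, ∀ τ ∈ convexHull ℝ C, d σ ≤ d τ := by
    have hne' : (convexHull ℝ C).Nonempty := hne.convexHull
    exact ⟨_, Function.argminOn_mem d _ hne', fun τ hτ => Function.argminOn_le d _ hτ⟩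
  have hσH := (hCs hσ).1.isHermitian
  have hPH := isHermitian_specProj {0}ᶜ σ
  have h1P : 1 - specProj {0}ᶜ σ = specProj {0} σ := by
    rw [← specProj_add_compl {0} hσH, add_sub_cancel_right]
  have hσ0 : σ * (1 - specProj {0}ᶜ σ) = 0 := by
    rw [h1P]
    nth_rw 1 [← cfc_self hσH]
    rw [specProj, cfc_mul_cfc]
    convert cfc_const_zero ℝ σ using 2
    ext x
    by_cases h : x = 0 <;> simp [h]
  refine ⟨σ, hσ, specProj {0}ᶜ σ, hPH, specProj_mul_self _ _, ?_, fun ρ hρ => ?_⟩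
  · rw [h1P]
    nth_rw 1 [← cfc_self hσH]
    rw [specProj, cfc_add_cfc]
    refine IsUnit.of_mul_eq_one (cfc (fun x : ℝ => (x + Set.indicator {0} 1 x)⁻¹) σ) ?_
    rw [cfc_mul_cfc, ← cfc_const_one hσH]
    congr 1
    ext x
    by_cases h : x = 0 <;> simp [h]
  · have hker : ∀ v, σ *ᵥ v = 0 → ρ *ᵥ v = 0 := by
      have hτ : (2⁻¹ : ℝ) • ρ + (2⁻¹ : ℝ) • σ ∈ convexHull ℝ C :=
        convex_convexHull ℝ C hρ hσ (by norm_num) (by norm_num) (by norm_num)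
      have hρp := (hCs hρ).1
      have hσp := (hCs hσ).1
      have hboth : ∀ v, ((2⁻¹ : ℝ) • ρ + (2⁻¹ : ℝ) • σ) *ᵥ v = 0 → ρ *ᵥ v = 0 ∧ σ *ᵥ v = 0 := by
        intro v hv
        have h0 : (ρ + σ) *ᵥ v = 0 := by
          rw [← smul_add, Matrix.smul_mulVec] at hv
          exact (smul_eq_zero.mp hv).resolve_left (by norm_num)
        have h1 : star v ⬝ᵥ ρ *ᵥ v + star v ⬝ᵥ σ *ᵥ v = 0 := by
          rw [← dotProduct_add, ← Matrix.add_mulVec, h0, dotProduct_zero]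
        have h2 := (add_eq_zero_iff_of_nonneg (hρp.dotProduct_mulVec_nonneg v)
          (hσp.dotProduct_mulVec_nonneg v)).mp h1
        exact ⟨(hρp.dotProduct_mulVec_zero_iff v).mp h2.1,
          (hσp.dotProduct_mulVec_zero_iff v).mp h2.2⟩
      have hle : LinearMap.ker (Matrix.mulVecLin ((2⁻¹ : ℝ) • ρ + (2⁻¹ : ℝ) • σ)) ≤
          LinearMap.ker (Matrix.mulVecLin σ) := fun v hv => by
        rw [LinearMap.mem_ker, Matrix.mulVecLin_apply] at hv ⊢
        exact (hboth v hv).2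
      have heq := Submodule.eq_of_le_of_finrank_le hle (hmin _ hτ)
      intro v hv
      have hv' : v ∈ LinearMap.ker (Matrix.mulVecLin σ) := hv
      rw [← heq] at hv'
      exact (hboth v hv').1
    have hρ0 : ρ * (1 - specProj {0}ᶜ σ) = 0 := by
      ext i j
      exact congrFun (hker (fun k => (1 - specProj {0}ᶜ σ) k j)
        (funext fun i' => congrFun (congrFun hσ0 i') j)) i
    have h2 : ρ * specProj {0}ᶜ σ = ρ := by
      rw [mul_sub, mul_one, sub_eq_zero] at hρ0
      exact hρ0.symm
    refine ⟨?_, h2⟩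
    have := congrArg Matrix.conjTranspose h2
    rwa [Matrix.conjTranspose_mul, hPH.eq, (hCs hρ).1.isHermitian.eq] at this

end Support

/-! ### A Petz-type recovery channel. -/

section Recovery

variable {n m ι : Type*} [Fintype n] [DecidableEq n] [Fintype m] [DecidableEq m] [Fintype ι]

/-- The linear map with given Kraus operators. -/
def krausMap (K : ι → Matrix m n ℂ) : Matrix n n ℂ →ₗ[ℂ] Matrix m m ℂ where
  toFun X := ∑ r, K r * X * (K r)ᴴ
  map_add' X Y := by simp [Matrix.mul_add, Matrix.add_mul, Finset.sum_add_distrib]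
  map_smul' c X := by simp [Finset.smul_sum]

lemma isCPTP_krausMap {K : ι → Matrix m n ℂ} (hK : ∑ r, (K r)ᴴ * K r = 1) :
    IsCPTP (krausMap K) where
  completelyPositive := isCompletelyPositive_of_kraus K fun _ => rfl
  trace_map X := by
    have h := trace_kraus (Φ := krausMap K) (K := K) (fun _ => rfl) X 1
    simpa [hK] using h

lemma pos_eq_self {X : Matrix n n ℂ} (hX : X.PosSemidef) : pos X = X := by
  conv_rhs => rw [← cfc_self hX.isHermitian]
  refine cfc_congr fun x hx => max_eq_left ?_
  exact spectrum_nonneg_of_nonneg (Matrix.nonneg_iff_posSemidef.mpr hX) hx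

/-- The Petz-type recovery for a reference operator `D`: it recovers every product `D a` for which
`a` commutes with `D` and with the compressed error operators. -/
lemma exists_recovery [Nonempty n] {K : ι → Matrix m n ℂ} (hK : ∑ r, (K r)ᴴ * K r = 1)
    {D : Matrix n n ℂ} (hD : D.PosSemidef) :
    ∃ R : Matrix m m ℂ →ₗ[ℂ] Matrix n n ℂ, IsCPTP R ∧ ∀ a : Matrix n n ℂ, Commute D a →
      (∀ i j, Commute a (CFC.sqrt D * (K i)ᴴ * K j * CFC.sqrt D)) →
      R (krausMap K (D * a)) = D * a := by
  classical
  have hsD := (posSemidef_sqrt D).isHermitian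
  -- The row of blocks `K i * √D`. Its Gram matrix `Γ` collects the compressed error operators, and
  -- `E (D * a)` becomes `L (1 ⊗ a) Lᴴ`.
  let L : Matrix m (ι × n) ℂ := Matrix.of fun b p => (K p.1 * CFC.sqrt D) b p.2
  have hΓ := Matrix.posSemidef_conjTranspose_mul_self L
  set Γ := Lᴴ * L with hΓdef
  have hΓblock : ∀ i j, Γ.submatrix (Prod.mk i) (Prod.mk j) =
      CFC.sqrt D * (K i)ᴴ * K j * CFC.sqrt D := by
    intro i j
    have : Γ.submatrix (Prod.mk i) (Prod.mk j) = (K i * CFC.sqrt D)ᴴ * (K j * CFC.sqrt D) := rfl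
    rw [this, Matrix.conjTranspose_mul, hsD.eq]
    simp only [Matrix.mul_assoc]
  -- Since `0⁻¹ = 0`, this is the pseudo-inverse of `√Γ`, and `U = L * g` is the partial isometry in
  -- the polar decomposition of `L`.
  set g := cfc (fun x : ℝ => (√x)⁻¹) Γ with hg
  set h := cfc (fun x : ℝ => √x) Γ with hh
  set s := specProj (Set.Ioi 0) Γ with hs
  have hgH : g.IsHermitian := isHermitian_cfc _ _
  have hhH : h.IsHermitian := isHermitian_cfc _ _
  have hhh : h * h = Γ := by
    conv_rhs => rw [← pos_eq_self hΓ]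
    rw [hh, cfc_mul_cfc, pos]
    congr 1
    ext x
    rcases le_total x 0 with hx | hx
    · simp [Real.sqrt_eq_zero_of_nonpos hx, hx]
    · simp [hx]
  have hgh : g * h = s := by
    rw [hg, hh, hs, specProj, cfc_mul_cfc]
    congr 1
    ext x
    rcases lt_or_ge 0 x with hx | hx
    · simp [hx, (Real.sqrt_pos.mpr hx).ne']
    · simp [Real.sqrt_eq_zero_of_nonpos hx, not_lt.mpr hx]
  have hhg : h * g = s := by rw [← hgh, hg, hh, cfc_mul_cfc, cfc_mul_cfc]; simp only [mul_comm]
  have hsh : s * h = h := by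
    rw [hh, hs, specProj, cfc_mul_cfc]
    congr 1
    ext x
    rcases lt_or_ge 0 x with hx | hx
    · simp [hx]
    · simp [Real.sqrt_eq_zero_of_nonpos hx]
  have hhs : h * s = h := by
    have := congrArg Matrix.conjTranspose hsh
    rwa [Matrix.conjTranspose_mul, hhH.eq, (isHermitian_specProj _ _).eq] at this
  have hss : s * s = s := specProj_mul_self _ _
  have hsg : s * g = g := by
    rw [hg, hs, specProj, cfc_mul_cfc]
    congr 1
    ext x
    rcases lt_or_ge 0 x with hx | hx
    · simp [hx]
    · simp [Real.sqrt_eq_zero_of_nonpos hx]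
  have hgs : g * s = g := by
    have := congrArg Matrix.conjTranspose hsg
    rwa [Matrix.conjTranspose_mul, hgH.eq, (isHermitian_specProj _ _).eq] at this
  have hLs : L * s = L := by
    have h1 : L * (1 - s) = 0 := by
      have hsΓ : (1 - s) * Γ = 0 := by
        nth_rw 1 [← pos_eq_self hΓ]
        rw [sub_mul, one_mul, specProj_mul_pos, sub_self]
      rw [← Matrix.conjTranspose_mul_self_eq_zero, Matrix.conjTranspose_mul,
        (Matrix.isHermitian_one.sub (isHermitian_specProj _ _)).eq, Matrix.mul_assoc,
        ← Matrix.mul_assoc Lᴴ, ← hΓdef, ← Matrix.mul_assoc, hsΓ, Matrix.zero_mul]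
    rw [Matrix.mul_sub, Matrix.mul_one, sub_eq_zero] at h1
    exact h1.symm
  set U := L * g with hU
  have hUU : Uᴴ * U = s := by
    rw [hU, Matrix.conjTranspose_mul, hgH.eq, Matrix.mul_assoc, ← Matrix.mul_assoc Lᴴ, ← hΓdef,
      ← hhh, Matrix.mul_assoc h, hhg, hhs, hgh]
  have hUs : U * s = U := by rw [hU, Matrix.mul_assoc, hgs]
  have hUh : U * h = L := by rw [hU, Matrix.mul_assoc, hgh, hLs]
  set Z := 1 - U * Uᴴ with hZ
  have hZH : Z.IsHermitian :=
    Matrix.isHermitian_one.sub (Matrix.isHermitian_mul_conjTranspose_self U)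
  have hZU : Z * U = 0 := by
    rw [hZ, Matrix.sub_mul, Matrix.one_mul, Matrix.mul_assoc, hUU, hUs, sub_self]
  have hZZ : Z * Z = Z := by
    nth_rw 2 [hZ]
    rw [Matrix.mul_sub, Matrix.mul_one, ← Matrix.mul_assoc, hZU, Matrix.zero_mul, sub_zero]
  have hZL : Z * L = 0 := by rw [← hUh, ← Matrix.mul_assoc, hZU, Matrix.zero_mul]
  obtain ⟨o⟩ := ‹Nonempty n›
  -- The blocks of `Uᴴ` followed by the trace over the error index; the part outside the range of
  -- `U` is sent to the basis state `o` to make the trace exact.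
  let T : ι ⊕ m → Matrix n m ℂ := Sum.elim (fun i => (U.submatrix id (Prod.mk i))ᴴ)
    (fun b => Matrix.single o b (1 : ℂ) * Z)
  refine ⟨krausMap T, isCPTP_krausMap ?_, fun a hDa hcomm => ?_⟩
  · rw [Fintype.sum_sum_type]
    have h1 : ∑ i, (T (Sum.inl i))ᴴ * T (Sum.inl i) = U * Uᴴ := by
      ext b c
      simp [T, Matrix.sum_apply, Matrix.mul_apply, Fintype.sum_prod_type]
    have h2 : ∑ b, (T (Sum.inr b))ᴴ * T (Sum.inr b) = Z := by
      have : ∀ b, (T (Sum.inr b))ᴴ * T (Sum.inr b) = Z * Matrix.single b b 1 * Z := by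
        intro b
        simp only [T, Sum.elim_inr, Matrix.conjTranspose_mul, hZH.eq, Matrix.conjTranspose_single]
        rw [Matrix.mul_assoc, ← Matrix.mul_assoc (Matrix.single b o _),
          Matrix.single_mul_single_same, ← Matrix.mul_assoc, star_one, mul_one]
      simp only [this]
      rw [← Finset.sum_mul, ← Finset.mul_sum]
      have h1 : ∑ b, Matrix.single b b (1 : ℂ) = (1 : Matrix m m ℂ) := by
        ext b c
        simp [Matrix.sum_apply, Matrix.single_apply, Matrix.one_apply, ite_and]
      rw [h1, Matrix.mul_one, hZZ]
    rw [h1, h2, hZ, add_sub_cancel]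
  · have hsa : Commute (CFC.sqrt D) a := commute_sqrt hDa
    let J : Matrix (ι × n) (ι × n) ℂ := (1 : Matrix ι ι ℂ) ⊗ₖ a
    have hF : krausMap K (D * a) = L * J * Lᴴ := by
      have h1 : ∀ i, K i * (D * a) * (K i)ᴴ = (K i * CFC.sqrt D) * a * (K i * CFC.sqrt D)ᴴ := by
        intro i
        rw [Matrix.conjTranspose_mul, hsD.eq]
        nth_rw 1 [← sqrt_mul_sqrt hD]
        have := hsa.eq
        rw [mul_assoc (CFC.sqrt D), this]
        simp only [Matrix.mul_assoc]
      have h2 : krausMap K (D * a) = ∑ i, K i * (D * a) * (K i)ᴴ := rfl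
      rw [h2]
      simp only [h1]
      have h3 : ∀ M : ι → Matrix m n ℂ, ∑ i, M i * a * (M i)ᴴ =
          (Matrix.of fun b (p : ι × n) => M p.1 b p.2) * J *
            (Matrix.of fun b (p : ι × n) => M p.1 b p.2)ᴴ := by
        intro M
        ext b c
        simp [Matrix.sum_apply, Matrix.mul_apply, J, Fintype.sum_prod_type, Matrix.one_apply]
      exact h3 _
    have hΓJblock : ∀ i j, (Γ * J).submatrix (Prod.mk i) (Prod.mk j) =
        Γ.submatrix (Prod.mk i) (Prod.mk j) * a := by
      intro i j
      ext b c
      simp [J, Matrix.mul_apply, Fintype.sum_prod_type, Matrix.one_apply]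
    have hJΓblock : ∀ i j, (J * Γ).submatrix (Prod.mk i) (Prod.mk j) =
        a * Γ.submatrix (Prod.mk i) (Prod.mk j) := by
      intro i j
      ext b c
      simp [J, Matrix.mul_apply, Fintype.sum_prod_type, Matrix.one_apply]
    -- Blockwise, this is the commutation of `a` with the compressed error operators.
    have hΓJ : Commute Γ J := by
      ext ⟨i, b⟩ ⟨j, c⟩
      have h1 := hΓJblock i j
      rw [hΓblock, ← (hcomm i j).eq, ← hΓblock, ← hJΓblock] at h1
      exact congrFun (congrFun h1 b) c
    have hhJ : Commute h J := commute_cfc hΓJ _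
    have hUFU : Uᴴ * (L * J * Lᴴ) * U = Γ * J := by
      have h1 : Uᴴ * L = h := by rw [← hUh, ← Matrix.mul_assoc, hUU, hsh]
      have h2 : Lᴴ * U = h := by
        have := congrArg Matrix.conjTranspose h1
        rwa [Matrix.conjTranspose_mul, Matrix.conjTranspose_conjTranspose, hhH.eq] at this
      calc Uᴴ * (L * J * Lᴴ) * U = (Uᴴ * L) * J * (Lᴴ * U) := by simp only [Matrix.mul_assoc]
        _ = Γ * J := by rw [h1, h2, Matrix.mul_assoc, ← hhJ.eq, ← Matrix.mul_assoc, hhh]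
    have h0 : krausMap T (L * J * Lᴴ) = ∑ r, T r * (L * J * Lᴴ) * (T r)ᴴ := rfl
    rw [hF, h0, Fintype.sum_sum_type]
    have h1 : ∀ i, T (Sum.inl i) * (L * J * Lᴴ) * (T (Sum.inl i))ᴴ =
        CFC.sqrt D * (K i)ᴴ * K i * CFC.sqrt D * a := by
      intro i
      rw [← hΓblock, ← hΓJblock, ← hUFU]
      simp only [T, Sum.elim_inl, Matrix.conjTranspose_conjTranspose]
      rfl
    have h2 : ∀ b, T (Sum.inr b) * (L * J * Lᴴ) * (T (Sum.inr b))ᴴ = 0 := by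
      intro b
      have : T (Sum.inr b) * (L * J * Lᴴ) = Matrix.single o b (1 : ℂ) * (Z * L) * J * Lᴴ := by
        simp only [T, Sum.elim_inr, Matrix.mul_assoc]
      rw [this, hZL]
      simp
    simp only [h1, h2]
    rw [Finset.sum_const_zero, add_zero, ← Finset.sum_mul, ← Finset.sum_mul]
    -- Only diagonal blocks survive the trace over the error index; completeness of `K` sums them to
    -- `D * a`.
    have h3 : ∑ i, CFC.sqrt D * (K i)ᴴ * K i = CFC.sqrt D := by
      simp only [Matrix.mul_assoc]
      rw [← Matrix.mul_sum, hK, Matrix.mul_one]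
    rw [h3, sqrt_mul_sqrt hD]

end Recovery

/-! ### From convex hulls to real spans. -/

section Span

variable {n m : Type*} [Fintype n] [DecidableEq n] [Fintype m] [DecidableEq m]

/-- Every element of the real span of a code is a weighted difference of two states of its
convex hull. -/
lemma exists_eq_sub_of_mem_span {C : Set (Matrix n n ℂ)} (hne : C.Nonempty) {X : Matrix n n ℂ}
    (hX : X ∈ Submodule.span ℝ C) :
    ∃ ρ ∈ convexHull ℝ C, ∃ σ ∈ convexHull ℝ C, ∃ a b : ℝ, 0 ≤ a ∧ 0 ≤ b ∧
      X = a • ρ - b • σ := by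
  obtain ⟨ρ₀, hρ₀⟩ := hne
  have hsub := subset_convexHull ℝ C
  have hconv := convex_convexHull ℝ C
  induction hX using Submodule.span_induction with
  | mem x hx => exact ⟨x, hsub hx, x, hsub hx, 1, 0, zero_le_one, le_rfl, by simp⟩
  | zero => exact ⟨ρ₀, hsub hρ₀, ρ₀, hsub hρ₀, 0, 0, le_rfl, le_rfl, by simp⟩
  | add x y _ _ hx hy =>
    obtain ⟨ρ, hρ, σ, hσ, a, b, ha, hb, rfl⟩ := hx
    obtain ⟨ρ', hρ', σ', hσ', a', b', ha', hb', rfl⟩ := hy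
    obtain ⟨τ, hτ, h1⟩ := hconv.exists_mem_add_smul_eq hρ hρ' ha ha'
    obtain ⟨τ', hτ', h2⟩ := hconv.exists_mem_add_smul_eq hσ hσ' hb hb'
    refine ⟨τ, hτ, τ', hτ', a + a', b + b', add_nonneg ha ha', add_nonneg hb hb', ?_⟩
    rw [h1, h2]
    abel
  | smul c x _ hx =>
    obtain ⟨ρ, hρ, σ, hσ, a, b, ha, hb, rfl⟩ := hx
    rcases le_total 0 c with hc | hc
    · exact ⟨ρ, hρ, σ, hσ, c * a, c * b, mul_nonneg hc ha, mul_nonneg hc hb, by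
        rw [smul_sub, smul_smul, smul_smul]⟩
    · refine ⟨σ, hσ, ρ, hρ, -c * b, -c * a, mul_nonneg (neg_nonneg.mpr hc) hb,
        mul_nonneg (neg_nonneg.mpr hc) ha, ?_⟩
      rw [smul_sub, smul_smul, smul_smul, neg_mul, neg_mul, neg_smul, neg_smul]
      abel

lemma convexHull_subset_span (C : Set (Matrix n n ℂ)) :
    convexHull ℝ C ⊆ Submodule.span ℝ C :=
  convexHull_min Submodule.subset_span (Submodule.span ℝ C).convex

lemma isHermitian_of_mem_span {C : Set (Matrix n n ℂ)} (hC : C ⊆ stateSpace n)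
    {X : Matrix n n ℂ} (hX : X ∈ Submodule.span ℝ C) : X.IsHermitian := by
  have h : Submodule.span ℝ C ≤ selfAdjoint.submodule ℝ (Matrix n n ℂ) :=
    Submodule.span_le.mpr fun ρ hρ => (hC hρ).1.isHermitian
  exact h hX

/-- By homogeneity the weights `a`, `b` normalise to `p`, `1 - p`, unless both vanish. -/
lemma IsPreserved.traceNorm_map_of_mem_span {E : Matrix n n ℂ →ₗ[ℂ] Matrix m m ℂ}
    {C : Set (Matrix n n ℂ)} (h : IsPreserved E C) (hne : C.Nonempty) {X : Matrix n n ℂ}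
    (hX : X ∈ Submodule.span ℝ C) : traceNorm (E X) = traceNorm X := by
  obtain ⟨ρ, hρ, σ, hσ, a, b, ha, hb, rfl⟩ := exists_eq_sub_of_mem_span hne hX
  rcases (add_nonneg ha hb).eq_or_lt with h0 | h0
  · have ha0 : a = 0 := by linarith
    have hb0 : b = 0 := by linarith
    simp [ha0, hb0, traceNorm]
  · have h1 : a • ρ - b • σ = (a + b) • ((a / (a + b)) • ρ - (1 - a / (a + b)) • σ) := by
      rw [smul_sub, smul_smul, smul_smul, mul_div_cancel₀ _ h0.ne', mul_sub,
        mul_div_cancel₀ _ h0.ne', mul_one, add_sub_cancel_left]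
    rw [h1, LinearMap.map_smul_of_tower, traceNorm_smul h0.le, traceNorm_smul h0.le,
      h.2 ρ hρ σ hσ _ ⟨by positivity, (div_le_one h0).mpr (by linarith)⟩]

end Span

/-! ### Maximality and the form of the code. -/

section Main

variable {n m ι : Type*} [Fintype n] [DecidableEq n] [Fintype m] [DecidableEq m] [Fintype ι]
  {K : ι → Matrix m n ℂ} {P : Matrix n n ℂ} {E : Matrix n n ℂ →ₗ[ℂ] Matrix m m ℂ}
  {e : Matrix n n ℂ →ₗ[ℂ] Matrix n n ℂ} {C : Set (Matrix n n ℂ)}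

/-- The trace projection onto the correctable algebra is isometric on a preserved code. -/
lemma IsTraceProjection.traceNorm_map_of_mem_span (he : IsTraceProjection K P e)
    (hE : ∀ X, E X = ∑ r, K r * X * (K r)ᴴ) (ht : ∀ X : Matrix n n ℂ, (E X).trace = X.trace)
    (hC : IsPreserved E C) (hP : P.IsHermitian) (hPP : P * P = P)
    {σ : Matrix n n ℂ} (hσ : σ ∈ convexHull ℝ C) (hσP : IsUnit (σ + (1 - P)))
    (hsupp : ∀ X ∈ Submodule.span ℝ C, P * X = X ∧ X * P = X)
    {X : Matrix n n ℂ} (hX : X ∈ Submodule.span ℝ C) : traceNorm (e X) = traceNorm X := by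
  have hne : C.Nonempty := convexHull_nonempty_iff.mp ⟨σ, hσ⟩
  have hσs := convexHull_min hC.1 convex_stateSpace hσ
  have hσV : σ ∈ Submodule.span ℝ C := convexHull_subset_span C hσ
  have hXH := isHermitian_of_mem_span hC.1 hX
  apply le_antisymm
  · refine traceNorm_map_le (fun Y hY => he.posSemidef hP hY) (fun Y hY => ?_) hXH
    have h := he.trace_mul Y P (proj_mem_correctableAlgebra hPP)
    rw [(he.mem Y).1] at h
    rw [h]
    exact re_trace_mul_le hY (posSemidef_one_sub hP hPP)
  · refine le_of_forall_pos_le_add fun δ hδ => ?_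
    -- The Helstrom argument needs nondegeneracy. Shifting by `ε • σ` costs `ε` once for `X` and
    -- once for `e X`, hence the bound `δ / 2`.
    obtain ⟨ε, hε0, hεδ, hker⟩ := exists_nondegenerate_shift (hsupp σ hσV).2 (hsupp X hX).2 hPP
      hσP (half_pos hδ)
    have hYV : X + ε • σ ∈ Submodule.span ℝ C := add_mem hX (Submodule.smul_mem _ _ hσV)
    have hYH := isHermitian_of_mem_span hC.1 hYV
    have hW := specProj_mem_correctableAlgebra_of_traceNorm_map hE ht hP hYH (hsupp _ hYV).1 hker
      (hC.traceNorm_map_of_mem_span hne hYV)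
    have h1 := he.traceNorm_le hP hPP hYH (hsupp _ hYV).1 hW
    have hS : (ε • σ).PosSemidef := hσs.1.smul hε0.le
    have htr : (ε • σ).trace.re = ε := by
      rw [Matrix.trace_smul, hσs.2]
      simp
    have h2 := traceNorm_le_add hXH hS
    have h3 := traceNorm_add_le (he.isHermitian hP hXH) (he.posSemidef hP hS)
    rw [he.trace_map hPP (by rw [Matrix.mul_smul, (hsupp σ hσV).1]), htr, ← map_add] at h3
    rw [htr] at h2
    linarith

/-- The states in the correctable algebra form a preserved code. -/
lemma isPreserved_correctableAlgebra (hE : ∀ X, E X = ∑ r, K r * X * (K r)ᴴ)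
    (ht : ∀ X : Matrix n n ℂ, (E X).trace = X.trace) :
    IsPreserved E (stateSpace n ∩ correctableAlgebra K P) := by
  refine ⟨Set.inter_subset_left, fun ρ hρ σ hσ p _ => ?_⟩
  have hX := isHermitian_sub_of_mem Set.inter_subset_left hρ hσ p (1 - p)
  have hconv : Convex ℝ (stateSpace n ∩ correctableAlgebra K P : Set (Matrix n n ℂ)) :=
    convex_stateSpace.inter ((correctableAlgebra K P).restrictScalars ℝ).convex
  rw [hconv.convexHull_eq] at hρ hσ
  exact traceNorm_map_of_mem_correctableAlgebra hE ht hX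
    (sub_mem (((correctableAlgebra K P).restrictScalars ℝ).smul_mem p hρ.2)
      (((correctableAlgebra K P).restrictScalars ℝ).smul_mem (1 - p) hσ.2))

/-- A Hermitian matrix is a linear combination of spectral projections for nonzero eigenvalues. -/
lemma exists_eq_sum_specProj {a : Matrix n n ℂ} (ha : a.IsHermitian) :
    ∃ s : Finset ℝ, 0 ∉ s ∧ a = ∑ x ∈ s, x • specProj {x} a := by
  refine ⟨(Matrix.finite_real_spectrum (A := a)).toFinset.erase 0, by simp, ?_⟩
  have h : ∀ x : ℝ, x • specProj {x} a = cfc (fun y => x * Set.indicator {x} 1 y) a := fun x =>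
    (cfc_const_mul x _ a (continuousOn_spectrum _ _)).symm
  simp only [h]
  rw [← cfc_sum _ _ _ fun _ _ => continuousOn_spectrum _ _]
  nth_rw 1 [← cfc_self ha]
  refine cfc_congr fun y hy => ?_
  rw [Finset.sum_apply]
  by_cases h0 : y = 0
  · subst h0
    refine (Finset.sum_eq_zero fun x hx => ?_).symm
    simp [(Finset.ne_of_mem_erase hx).symm]
  · rw [Finset.sum_eq_single_of_mem y (by simp [h0, hy])]
    · simp
    · intro x _ hx
      simp [hx.symm]

/-- A section `v` of the trace projection over the projections of the correctable algebra
multiplies by a fixed operator. -/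
lemma IsTraceProjection.mul_eq_of_map_eq (he : IsTraceProjection K P e) (hP : P.IsHermitian)
    (hPP : P * P = P) {W v v' : Matrix n n ℂ} (hW : W ∈ correctableAlgebra K P)
    (hWH : W.IsHermitian) (hWW : W * W = W) (hv : v.PosSemidef) (hv' : v'.PosSemidef)
    (hPv : P * v = v) (hPv' : P * v' = v') (hev : e v = W) (hev' : e v' = P - W) :
    (v + v') * W = v := by
  have key : ∀ {w Q : Matrix n n ℂ}, w.PosSemidef → P * w = w → e w = Q → Q.IsHermitian →
      Q * Q = Q → w * (1 - Q) = 0 := by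
    intro w Q hw hPw hew hQ hQQ
    have hQA : Q ∈ correctableAlgebra K P := hew ▸ he.mem w
    -- Since `P - Q` is in the algebra, `tr ((P - Q) w) = tr ((P - Q) Q) = 0`: a positive lift of
    -- `Q` is supported under `Q`.
    have h1 : ((1 - Q) * w).trace = 0 := by
      have h2 := he.trace_mul w (P - Q) (sub_mem (proj_mem_correctableAlgebra hPP) hQA)
      rw [hew, sub_mul, hQA.1, hQQ, sub_self, Matrix.trace_zero, sub_mul, hPw] at h2
      rw [sub_mul, one_mul, ← h2]
    have h2 := mul_eq_zero_of_trace_mul hw (posSemidef_one_sub hQ hQQ) h1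
    have := congrArg Matrix.conjTranspose h2
    rwa [Matrix.conjTranspose_mul, (posSemidef_one_sub hQ hQQ).isHermitian.eq,
      hw.isHermitian.eq, Matrix.conjTranspose_zero] at this
  have h1 := key hv hPv hev hWH hWW
  have h2 := key hv' hPv' hev' (hP.sub hWH) (by simp [sub_mul, mul_sub, hPP, hWW, hW.1, hW.2.1])
  have h3 : v' * W = 0 := by
    have : (1 - (P - W)) * W = W := by simp [sub_mul, hW.1, hWW]
    rw [← this, ← mul_assoc, h2, zero_mul]
  rw [mul_sub, mul_one, sub_eq_zero] at h1
  rw [add_mul, h3, add_zero, ← h1]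

/-- Maximum preserved codes are correctable. -/
theorem IsMaximumPreserved.exists_isFixed [Nonempty n] (hE : IsCPTP E)
    (hC : IsMaximumPreserved E C) :
    ∃ R : Matrix m m ℂ →ₗ[ℂ] Matrix n n ℂ, IsCPTP R ∧ IsFixed (R ∘ₗ E) C := by
  obtain ⟨k, K, hK⟩ := hE.completelyPositive.exists_kraus
  have ht := hE.trace_map
  have hK1 := sum_kraus_eq_one hK ht
  have hEK : E = krausMap K := LinearMap.ext hK
  rcases C.eq_empty_or_nonempty with rfl | hne
  · obtain ⟨R, hR, -⟩ := exists_recovery hK1 (Matrix.PosSemidef.zero (n := n))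
    exact ⟨R, hR, fun ρ hρ => hρ.elim⟩
  obtain ⟨hpres, hmax⟩ := hC
  obtain ⟨σ, hσ, P, hP, hPP, hσP, hsupp⟩ := exists_support hpres.1 hne
  have hsuppV : ∀ X ∈ Submodule.span ℝ C, P * X = X ∧ X * P = X := by
    intro X hX
    obtain ⟨ρ, hρ, τ, hτ, a, b, -, -, rfl⟩ := exists_eq_sub_of_mem_span hne hX
    simp only [mul_sub, sub_mul, Matrix.mul_smul, Matrix.smul_mul, hsupp ρ hρ, hsupp τ hτ,
      and_self]
  obtain ⟨e, he1, he2⟩ := exists_trace_projection (correctableAlgebra K P)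
    (fun a ha => conjTranspose_mem_correctableAlgebra hP ha)
  have he : IsTraceProjection K P e := ⟨he1, he2⟩
  have hiso : ∀ X ∈ Submodule.span ℝ C, traceNorm (e X) = traceNorm X := fun X hX =>
    he.traceNorm_map_of_mem_span hK ht hpres hP hPP hσ hσP hsuppV hX
  have hinj : ∀ X ∈ Submodule.span ℝ C, ∀ Y ∈ Submodule.span ℝ C, e X = e Y → X = Y := by
    intro X hX Y hY hXY
    have h1 := hiso _ (sub_mem hX hY)
    rw [map_sub, hXY, sub_self] at h1
    rw [← sub_eq_zero]
    apply eq_zero_of_traceNorm_eq_zero (isHermitian_of_mem_span hpres.1 (sub_mem hX hY))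
    rw [← h1]
    simp [traceNorm]
  have hspan : C ⊆ Submodule.span ℝ C := Submodule.subset_span
  have himage : e '' C = stateSpace n ∩ correctableAlgebra K P := by
    have hsub : e '' C ⊆ stateSpace n ∩ correctableAlgebra K P := by
      rintro _ ⟨ρ, hρ, rfl⟩
      refine ⟨⟨he.posSemidef hP (hpres.1 hρ).1, ?_⟩, he.mem ρ⟩
      rw [he.trace_map hPP (hsuppV ρ (hspan hρ)).1]
      exact (hpres.1 hρ).2
    -- The only use of maximality: otherwise `e` would embed `C` as a strict subset of the preserved
    -- code of all states in the algebra.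
    by_contra hneq
    refine hmax ⟨_, e '' C, isPreserved_correctableAlgebra hK ht,
      hsub.ssubset_of_ne hneq, e.restrictScalars ℝ, ?_, ?_⟩
    · exact Set.InjOn.bijOn_image fun X hX Y hY h => hinj X (hspan hX) Y (hspan hY) h
    · intro ρ hρ τ hτ p _
      have hV := convexHull_subset_span C
      rw [← map_smul, ← map_smul, ← map_sub]
      exact hiso _ (sub_mem (Submodule.smul_mem _ _ (hV hρ)) (Submodule.smul_mem _ _ (hV hτ)))
  -- A nonzero projection is a positive multiple of a state of the algebra, so its lift is a
  -- multiple of a code state and hence positive.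
  have hlift : ∀ W ∈ correctableAlgebra K P, W.IsHermitian → W * W = W →
      ∃ v ∈ Submodule.span ℝ C, v.PosSemidef ∧ e v = W := by
    intro W hW hWH hWW
    have hWp := posSemidef_of_isHermitian_of_mul_self hWH hWW
    rcases (re_trace_nonneg hWp).eq_or_lt with h0 | h0
    · exact ⟨0, zero_mem _, Matrix.PosSemidef.zero, by
        rw [map_zero, PosSemidef.eq_zero_of_re_trace hWp h0.symm.le]⟩
    · have hmem : (W.trace.re)⁻¹ • W ∈ stateSpace n ∩ correctableAlgebra K P := by
        refine ⟨⟨hWp.smul (inv_nonneg.mpr h0.le), ?_⟩,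
          ((correctableAlgebra K P).restrictScalars ℝ).smul_mem _ hW⟩
        have him := (Complex.le_def.mp hWp.trace_nonneg).2
        have htr : W.trace = (W.trace.re : ℂ) := Complex.ext rfl (by simpa using him.symm)
        rw [Matrix.trace_smul, htr, Complex.ofReal_re, Complex.real_smul, ← Complex.ofReal_mul,
          inv_mul_cancel₀ h0.ne', Complex.ofReal_one]
      rw [← himage] at hmem
      obtain ⟨ρ, hρ, hρW⟩ := hmem
      refine ⟨W.trace.re • ρ, Submodule.smul_mem _ _ (hspan hρ), (hpres.1 hρ).1.smul h0.le, ?_⟩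
      rw [LinearMap.map_smul_of_tower, hρW, smul_smul, mul_inv_cancel₀ h0.ne', one_smul]
  obtain ⟨D, hDV, hD, heD⟩ := hlift P (proj_mem_correctableAlgebra hPP) hP hPP
  have hDW : ∀ W ∈ correctableAlgebra K P, W.IsHermitian → W * W = W →
      D * W ∈ Submodule.span ℝ C ∧ e (D * W) = W ∧ Commute D W := by
    intro W hW hWH hWW
    obtain ⟨v, hvV, hv, hev⟩ := hlift W hW hWH hWW
    obtain ⟨v', hvV', hv', hev'⟩ := hlift (P - W) (sub_mem (proj_mem_correctableAlgebra hPP) hW)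
      (hP.sub hWH) (by simp [sub_mul, mul_sub, hPP, hWW, hW.1, hW.2.1])
    -- Both sides lie in the span and are mapped by `e` to `P`, where `e` is injective.
    have hDv : v + v' = D := hinj _ (add_mem hvV hvV') _ hDV (by
      rw [map_add, hev, hev', heD, add_sub_cancel])
    have h1 := he.mul_eq_of_map_eq hP hPP hW hWH hWW hv hv' (hsuppV v hvV).1 (hsuppV v' hvV').1
      hev hev'
    rw [hDv] at h1
    refine ⟨h1 ▸ hvV, h1 ▸ hev, ?_⟩
    have h2 := congrArg Matrix.conjTranspose h1
    rw [Matrix.conjTranspose_mul, hWH.eq, hD.isHermitian.eq, hv.isHermitian.eq] at h2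
    exact h1.trans h2.symm
  have hsqrtP : CFC.sqrt D * P = CFC.sqrt D := by
    have h1 : CFC.sqrt D * (1 - P) = 0 := by
      rw [← Matrix.conjTranspose_mul_self_eq_zero, Matrix.conjTranspose_mul, Matrix.mul_assoc,
        ← Matrix.mul_assoc (CFC.sqrt D)ᴴ, sqrt_mul_sqrt' hD, mul_sub D, (hsuppV D hDV).2]
      simp
    rw [mul_sub, mul_one, sub_eq_zero] at h1
    exact h1.symm
  have hPsqrt : P * CFC.sqrt D = CFC.sqrt D := by
    have := congrArg Matrix.conjTranspose hsqrtP
    rwa [Matrix.conjTranspose_mul, hP.eq, (posSemidef_sqrt D).isHermitian.eq] at this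
  obtain ⟨R, hR, hrec⟩ := exists_recovery hK1 hD
  refine ⟨R, hR, fun ρ hρ => ?_⟩
  have haH := he.isHermitian hP (hpres.1 hρ).1.isHermitian
  obtain ⟨s, hs0, hsum⟩ := exists_eq_sum_specProj haH
  have hproj : ∀ x ∈ s, D * specProj {x} (e ρ) ∈ Submodule.span ℝ C ∧
      e (D * specProj {x} (e ρ)) = specProj {x} (e ρ) ∧ Commute D (specProj {x} (e ρ)) :=
    fun x hx => hDW _ (specProj_mem_correctableAlgebra (he.mem ρ) haH (by
      rintro rfl
      exact hs0 hx)) (isHermitian_specProj _ _) (specProj_mul_self _ _)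
  have hDa : D * e ρ = ∑ x ∈ s, x • (D * specProj {x} (e ρ)) := by
    conv_lhs => rw [hsum]
    rw [Finset.mul_sum]
    simp only [Matrix.mul_smul]
  -- The spectral projections of `e ρ` lift to their products with `D`, so both sides are lifts of
  -- `e ρ`.
  have hρD : ρ = D * e ρ := by
    refine hinj _ (hspan hρ) _ ?_ ?_
    · rw [hDa]
      exact sum_mem fun x hx => Submodule.smul_mem _ _ (hproj x hx).1
    · rw [hDa, map_sum]
      conv_lhs => rw [hsum]
      refine Finset.sum_congr rfl fun x hx => ?_
      rw [LinearMap.map_smul_of_tower, (hproj x hx).2.1]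
  have hcomm : Commute D (e ρ) := by
    rw [hsum]
    exact Commute.sum_right _ _ _ fun x hx => (hproj x hx).2.2.smul_right x
  have hfix := hrec (e ρ) hcomm fun i j => by
    -- `√D` absorbs `P`, which turns the operators compressed by `√D` into products of `√D` with
    -- those defining the algebra.
    have h1 : CFC.sqrt D * (K i)ᴴ * K j * CFC.sqrt D =
        CFC.sqrt D * (P * (K i)ᴴ * K j * P) * CFC.sqrt D := by
      rw [Matrix.mul_assoc (CFC.sqrt D) _ (CFC.sqrt D), Matrix.mul_assoc _ P, hPsqrt]
      simp only [← Matrix.mul_assoc, hsqrtP]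
    have h2 : Commute (e ρ) (CFC.sqrt D) := (commute_sqrt hcomm).symm
    rw [h1]
    exact (h2.mul_right ((he.mem ρ).2.2 i j)).mul_right h2
  rw [← hρD, ← hEK] at hfix
  exact hfix

end Main

end QuantumCode

end

theorem mainTheorem3 {n m : Type*} [Fintype n] [DecidableEq n] [Nonempty n]
    [Fintype m] [DecidableEq m]
    (E : Matrix n n ℂ →ₗ[ℂ] Matrix m m ℂ) (hE : QuantumCode.IsCPTP E) :
    (∀ C : Set (Matrix n n ℂ), QuantumCode.IsMaximumPreserved E C →
      ∃ R : Matrix m m ℂ →ₗ[ℂ] Matrix n n ℂ,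
        QuantumCode.IsCPTP R ∧ QuantumCode.IsFixed (R ∘ₗ E) C) ∧
    (∀ C : Set (Matrix n n ℂ), C ⊆ QuantumCode.stateSpace n →
      (∃ R : Matrix m m ℂ →ₗ[ℂ] Matrix n n ℂ,
        QuantumCode.IsCPTP R ∧ QuantumCode.IsFixed (R ∘ₗ E) C) →
      QuantumCode.IsPreserved E C) :=
  ⟨fun _ hC => hC.exists_isFixed hE,
    fun _ hC ⟨_, hR, hRE⟩ => QuantumCode.isPreserved_of_isFixed hE hC hR hRE⟩
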